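/- Let $1\le d\le n$. **Linear model.** $X$ is an $n\times d$ matrix with i.i.d. $N(0,1)$ entries, $\epsilon\sim N(0,I_n)$ is independent of $X$, and one observes $(y,X)$ with $y=X\beta+\epsilon$, $\beta\in\mathbb R^d$. Estimators are measurable maps $\hat\beta=\hat\beta(y,X)\in\mathbb R^d$, with risk $R(\hat\beta,\beta)=E_\beta\|\hat\beta(y,X)-\beta\|^2\in[0,\infty]$, where the expectation is over $(X,\epsilon)$. The estimator is orthogonally equivariant if $U^T\hat\beta(y,X)=\hat\beta(y,XU)$ for all $U\in O(d)$ and all $(y,X)$. Let $S(c)=\{b\in\mathbb R^d:\|b\|=c\}$, let $\pi_c$ be the uniform probability measure on $S(c)$, and put $$R^{(e)}(\beta)=\inf_{\hat\beta\text{ equivariant}}R(\hat\beta,\beta),\qquad R^{(s)}(c)=\inf_{\hat\beta}\sup_{\beta\in S(c)}R(\hat\beta,\beta),$$ $$\hat\beta_{unif}(c)=E_{\pi_c}(\beta\mid y,X),\qquad \hat\beta_r(c)=\Bigl(X^TX+\tfrac{d}{c^2}I\Bigr)^{-1}X^Ty,$$ with $\beta\sim\pi_c$ independent of $(X,\epsilon)$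 in the posterior mean, and with $\hat\beta_r(0)=0$, $\hat\beta_r(\infty)=(X^TX)^{-1}X^Ty$. **Sequence model.** $\Sigma$ is a random $d\times d$ matrix that is almost surely positive definite and whose law is invariant under $\Sigma\mapsto U\Sigma U^T$, $U\in O(d)$; $\delta_0\sim N(0,I_d)$ is independent of $\Sigma$, and one observes $(z,\Sigma)$ with $z=\theta+\Sigma^{1/2}\delta_0$, $\theta\in\mathbb R^d$. Estimators are measurable maps $\hat\theta=\hat\theta(z,\Sigma)$, with risk $\tilde R(\hat\theta,\theta)=E_\theta\|\hat\theta(z,\Sigma)-\theta\|^2$; such an estimator is orthogonally equivariant if $U\hat\theta(z,\Sigma)=\hat\theta(Uz,U\Sigma U^T)$ for all $U\in O(d)$ and all $(z,\Sigma)$. The quantities $\tilde R^{(e)}(\theta)$, $\tilde R^{(s)}(c)$ and $\hat\theta_{unif}(c)=E_{\pi_c}(\theta\mid z,\Sigma)$ are defined as before, and for $0\le c<\infty$ $$\hat\theta_r(c)=E_{N(0,(c^2/d)I)}(\theta\mid z,\Sigma)=\tfrac{c^2}{d}\Bigl(\Sigma+\tfrac{c^2}{d}I\Bigr)^{-1}z\quad\text{a.s.},$$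 with $\hat\theta_r(\infty)=z$ (in the posterior means $\theta$ is independent of $(\Sigma,\delta_0)$). **Proposition.** Take the sequence model in which $\Sigma$ has the law of $(X^TX)^{-1}$. This law meets the requirements above, and for every $\beta\in\mathbb R^d$ the pair $\bigl((X^TX)^{-1}X^Ty,(X^TX)^{-1}\bigr)$ computed from the linear model with parameter $\beta$ has the law of $(z,\Sigma)$ in the sequence model with parameter $\theta=\beta$. (a) Let $\theta=\beta\in\mathbb R^d$, $z=(X^TX)^{-1}X^Ty$ and $\Sigma=(X^TX)^{-1}$. Almost surely, $\hat\beta_{unif}(c)=\hat\theta_{unif}(c)$ for each $c\in[0,\infty)$ and $\hat\beta_r(c)=\hat\theta_r(c)$ for each $c\in[0,\infty]$ (the latter including the two expressions for $\hat\theta_r(c)$ above when $c<\infty$), and $$R\{\hat\beta_r(c),\beta\}=\tilde R\{\hat\theta_r(c),\theta\}\quad\text{for each }c\in[0,\infty].$$ (b) If $\|\theta\|=\|\beta\|=c$, then $$R\{\hat\beta_{unif}(c),\beta\}=R^{(e)}(\beta)=R^{(s)}(c)=\tilde R^{(s)}(c)=\tilde R^{(e)}(\theta)=\tilde R\{\hat\theta_{unif}(c),\theta\}.$$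 -/

import Mathlib

open MeasureTheory ProbabilityTheory
open scoped ENNReal Matrix

noncomputable section

namespace DenseRegression

/-- Euclidean space `ℝᵏ` with the `ℓ²`-norm. -/
abbrev E (k : ℕ) : Type := EuclideanSpace ℝ (Fin k)

/-- Real `k × l` matrices. -/
abbrev Mat (k l : ℕ) : Type := Matrix (Fin k) (Fin l) ℝ

/-- The product (that is, Borel) sigma-algebra on matrices. -/
instance instMeasurableSpaceMat (k l : ℕ) : MeasurableSpace (Mat k l) :=
  inferInstanceAs (MeasurableSpace (Fin k → Fin l → ℝ))

instance instBorelSpaceMat (k l : ℕ) : BorelSpace (Mat k l) :=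
  inferInstanceAs (BorelSpace (Fin k → Fin l → ℝ))

/-! ### Generic decision-theoretic notions

A statistical model is given by a noise law `P` on `Ω` and a data map `D : Θ → Ω → 𝓧`: under the
parameter `θ` one observes `D θ ω` with `ω ∼ P`. -/

section Generic

variable {k : ℕ} {Ω 𝓧 : Type*} [MeasurableSpace Ω] [MeasurableSpace 𝓧]

/-- Squared error risk `E_θ ‖f(data) - θ‖²`, with values in `[0, ∞]`. -/
def sqRisk (P : Measure Ω) (D : E k → Ω → 𝓧) (f : 𝓧 → E k) (θ : E k) : ℝ≥0∞ :=
  ∫⁻ ω, ‖f (D θ ω) - θ‖ₑ ^ 2 ∂P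

/-- Minimax risk over the sphere of radius `c`; the infimum is over all measurable estimators. -/
def sphereMinimaxRisk (P : Measure Ω) (D : E k → Ω → 𝓧) (c : ℝ) : ℝ≥0∞ :=
  ⨅ (f : 𝓧 → E k) (_ : Measurable f), ⨆ θ ∈ Metric.sphere (0 : E k) c, sqRisk P D f θ

/-- The posterior mean `x ↦ E_π(θ | data = x)`, where `θ ∼ π` is independent of the noise: the mean
of the regular conditional distribution of the parameter given the data. -/
def posteriorMean (π : Measure (E k)) [IsFiniteMeasure π] (P : Measure Ω) [IsFiniteMeasure P]
    (D : E k → Ω → 𝓧) (x : 𝓧) : E k :=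
  ∫ b, b ∂(condDistrib (fun p : E k × Ω => p.1) (fun p : E k × Ω => D p.1 p.2) (π.prod P) x)

end Generic

/-- The uniform probability measure on the sphere `{b ∈ ℝᵏ : ‖b‖ = c}`: normalised surface measure
of the unit sphere, scaled by `c`. -/
def sphereUniform (k : ℕ) (c : ℝ) : Measure (E k) :=
  (((volume : Measure (E k)).toSphere)[|Set.univ]).map
    (fun u : Metric.sphere (0 : E k) 1 => c • (u : E k))

instance instIsFiniteMeasureSphereUniform (k : ℕ) (c : ℝ) :
    IsFiniteMeasure (sphereUniform k c) := by
  unfold sphereUniform; infer_instance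

/-! ### The linear model `y = X β + ε` -/

/-- The law of an `n × d` matrix with rows i.i.d. `N(0, I_d)`, that is, with i.i.d. `N(0,1)`
entries. -/
def gaussianDesign (n d : ℕ) : Measure (Mat n d) :=
  Measure.pi fun _ : Fin n => Measure.pi fun _ : Fin d => gaussianReal 0 1

instance instIsProbabilityMeasureGaussianDesign (n d : ℕ) :
    IsProbabilityMeasure (gaussianDesign n d) :=
  inferInstanceAs (IsProbabilityMeasure
    (Measure.pi fun _ : Fin n => Measure.pi fun _ : Fin d => gaussianReal 0 1))

/-- The joint law of `(X, ε)`: `X` and `ε ∼ N(0, I_n)` are independent. -/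
def linNoise (n d : ℕ) : Measure (Mat n d × E n) :=
  (gaussianDesign n d).prod (stdGaussian (E n))

instance instIsProbabilityMeasureLinNoise (n d : ℕ) : IsProbabilityMeasure (linNoise n d) := by
  unfold linNoise; infer_instance

/-- The observed data `(y, X) = (X β + ε, X)`. -/
def linData {n d : ℕ} (β : E d) (ω : Mat n d × E n) : E n × Mat n d :=
  (Matrix.toEuclideanLin ω.1 β + ω.2, ω.1)

/-- The risk `R(f, β)`. -/
def linRisk {n d : ℕ} (f : E n × Mat n d → E d) (β : E d) : ℝ≥0∞ :=
  sqRisk (linNoise n d) linData f β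

/-- Orthogonal equivariance in the linear model: `Uᵀ f(y, X) = f(y, X U)` for `U ∈ O(d)`. -/
def LinEquivariant {n d : ℕ} (f : E n × Mat n d → E d) : Prop :=
  ∀ U ∈ Matrix.orthogonalGroup (Fin d) ℝ, ∀ (y : E n) (X : Mat n d),
    Matrix.toEuclideanLin Uᵀ (f (y, X)) = f (y, X * U)

/-- The minimal equivariant risk `R^(e)(β)`. -/
def linEquivRisk (n : ℕ) {d : ℕ} (β : E d) : ℝ≥0∞ :=
  ⨅ (f : E n × Mat n d → E d) (_ : Measurable f) (_ : LinEquivariant f), linRisk f β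

/-- The minimax risk over the sphere, `R^(s)(c)`. -/
def linSphereRisk (n d : ℕ) (c : ℝ) : ℝ≥0∞ :=
  sphereMinimaxRisk (k := d) (linNoise n d) linData c

/-- The Bayes estimator for the uniform prior on the sphere of radius `c`. -/
def linUnif {n d : ℕ} (c : ℝ) : E n × Mat n d → E d :=
  posteriorMean (sphereUniform d c) (linNoise n d) linData

/-- The ridge estimator `(XᵀX + (d/c²) I)⁻¹ Xᵀ y`, `c ∈ [0, ∞]`; it is `0` for `c = 0` and the
ordinary least squares estimator for `c = ∞` (where `d/c² = 0`). -/
def linRidge {n d : ℕ} (c : ℝ≥0∞) (x : E n × Mat n d) : E d :=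
  if c = 0 then 0 else
    Matrix.toEuclideanLin
      ((x.2ᵀ * x.2 + ((d : ℝ≥0∞) / c ^ 2).toReal • (1 : Mat d d))⁻¹ * x.2ᵀ) x.1

/-! ### The sequence model `z = θ + Σ^{1/2} δ₀` -/

/-- The standing requirements on the law `ν` of the random `m × m` matrix `Σ` in the sequence
model: `Σ` is almost surely positive definite, and orthogonally invariant in law. -/
structure IsSeqCovLaw {m : ℕ} (ν : Measure (Mat m m)) : Prop where
  isProbabilityMeasure : IsProbabilityMeasure ν
  ae_posDef : ∀ᵐ S ∂ν, S.PosDef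
  invariant : ∀ U ∈ Matrix.orthogonalGroup (Fin m) ℝ, ν.map (fun S => U * S * Uᵀ) = ν

/-- The joint law of `(Σ, δ₀)`: `Σ ∼ ν` and `δ₀ ∼ N(0, I_m)` are independent. -/
def seqNoise {m : ℕ} (ν : Measure (Mat m m)) : Measure (Mat m m × E m) :=
  ν.prod (stdGaussian (E m))

instance instIsFiniteMeasureSeqNoise {m : ℕ} (ν : Measure (Mat m m)) [IsFiniteMeasure ν] :
    IsFiniteMeasure (seqNoise ν) := by
  unfold seqNoise; infer_instance

open scoped MatrixOrder in
/-- The observed data `(z, Σ) = (θ + Σ^{1/2} δ₀, Σ)`. -/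
def seqData {m : ℕ} (θ : E m) (ω : Mat m m × E m) : E m × Mat m m :=
  (θ + Matrix.toEuclideanLin (CFC.sqrt ω.1) ω.2, ω.1)

section Seq

variable {m : ℕ} (ν : Measure (Mat m m))

/-- The risk in the sequence model. -/
def seqRisk (f : E m × Mat m m → E m) (θ : E m) : ℝ≥0∞ :=
  sqRisk (seqNoise ν) seqData f θ

/-- Orthogonal equivariance in the sequence model: `U f(z, Σ) = f(U z, U Σ Uᵀ)` for `U ∈ O(m)`. -/
def SeqEquivariant (f : E m × Mat m m → E m) : Prop :=
  ∀ U ∈ Matrix.orthogonalGroup (Fin m) ℝ, ∀ (z : E m) (S : Mat m m),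
    Matrix.toEuclideanLin U (f (z, S)) = f (Matrix.toEuclideanLin U z, U * S * Uᵀ)

/-- The minimal equivariant risk in the sequence model. -/
def seqEquivRisk (θ : E m) : ℝ≥0∞ :=
  ⨅ (f : E m × Mat m m → E m) (_ : Measurable f) (_ : SeqEquivariant f), seqRisk ν f θ

/-- The minimax risk over the sphere of radius `c` in the sequence model. -/
def seqSphereRisk (c : ℝ) : ℝ≥0∞ :=
  sphereMinimaxRisk (seqNoise ν) seqData c

/-- The Bayes estimator for the uniform prior on the sphere of radius `c`. -/
def seqUnif [IsFiniteMeasure ν] (c : ℝ) : E m × Mat m m → E m :=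
  posteriorMean (sphereUniform m c) (seqNoise ν) seqData

/-- The ridge estimator of the sequence model: the Bayes estimator for the prior
`N(0, (c²/m) I_m)` if `c < ∞`, and `z` itself if `c = ∞`. -/
def seqRidge [IsFiniteMeasure ν] (c : ℝ≥0∞) (x : E m × Mat m m) : E m :=
  if c = ⊤ then x.1 else
    posteriorMean (multivariateGaussian 0 ((c.toReal ^ 2 / m) • (1 : Mat m m)))
      (seqNoise ν) seqData x

end Seq

/-- The linear form `(c²/m) (Σ + (c²/m) I)⁻¹ z` of the ridge estimator in the sequence model. -/
def seqRidgeForm {m : ℕ} (c : ℝ) (x : E m × Mat m m) : E m :=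
  (c ^ 2 / m) • Matrix.toEuclideanLin ((x.2 + (c ^ 2 / m) • (1 : Mat m m))⁻¹) x.1

/-! ### From the linear model to the sequence model -/

/-- The law of `(XᵀX)⁻¹`. -/
def invGramLaw (n d : ℕ) : Measure (Mat d d) :=
  (gaussianDesign n d).map fun X => (Xᵀ * X)⁻¹

instance instIsFiniteMeasureInvGramLaw (n d : ℕ) : IsFiniteMeasure (invGramLaw n d) := by
  unfold invGramLaw; infer_instance

/-- The passage from `(y, X)` to `(z, Σ) = ((XᵀX)⁻¹ Xᵀ y, (XᵀX)⁻¹)`. -/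
def toSeq {n d : ℕ} (x : E n × Mat n d) : E d × Mat d d :=
  (Matrix.toEuclideanLin ((x.2ᵀ * x.2)⁻¹ * x.2ᵀ) x.1, (x.2ᵀ * x.2)⁻¹)

end DenseRegression

end

open DenseRegression

/-!
The least squares map `toSeq : (y, X) ↦ (z, Σ) = ((XᵀX)⁻¹Xᵀy, (XᵀX)⁻¹)` carries the linear model to
the sequence model, and nothing relevant is lost, because it is sufficient.

*Laws.* The Gram matrix is almost surely invertible (`ae_gram_posDef`). Given `X`, the vector
`z - β = (XᵀX)⁻¹Xᵀε` is Gaussian with covariance `Σ`, as is `Σ^{1/2} δ₀` (`map_toSeq_linData`).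
Invariance of the law of `Σ` comes from that of the Gaussian design under `X ↦ XU`.

*Posterior means.* By the Cameron–Martin formula the linear model has, relative to `β = 0`, the
likelihood `b ↦ exp(⟨b, Xᵀy⟩ - ⟨b, XᵀX b⟩ / 2)` (`map_linData_eq_withDensity`). It is a function of
`(z, Σ)`, namely `exp(⟨b, Σ⁻¹z⟩ - ⟨b, Σ⁻¹b⟩ / 2)` (`seqLik_toSeq`), which therefore is a likelihood
of the sequence model too. Bayes' rule (`posteriorMean_ae_eq`) then gives both posterior means as the
same weighted mean. Since the likelihoods are positive, all the parameters give mutually absolutely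
continuous laws, and exceptional sets for the prior mixture are null under every fixed parameter.
For a Gaussian prior the weighted mean is evaluated by completing the square
(`weightedMean_gaussian_shiftLik`), which is the ridge estimator.

*Risks.* The risk of `f` in the sequence model is the risk of `f ∘ toSeq` in the linear model
(`seqRisk_eq_linRisk`), and `f ∘ toSeq` is equivariant when `f` is. Equivariant estimators have
constant risk on spheres, since `O(d)` acts transitively on them. The weighted mean for the uniform
prior on the sphere is exactly equivariant, so its constant risk is its Bayes risk, which bounds from
below the risk of any equivariant estimator and the maximal risk over the sphere of any estimator
(`linRisk_linUnif_le_lintegral`). It also attains these bounds, in both models.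
-/

namespace DenseRegression

/-! ### Bayes' rule and Bayes optimality in a dominated model -/

section Dominated

variable {k : ℕ} {Ω 𝓧 : Type*} [MeasurableSpace Ω] [MeasurableSpace 𝓧]

/-- The mean of the probability measure with density proportional to `L` with respect to `π`. -/
noncomputable def weightedMean (π : Measure (E k)) (L : E k → ℝ) : E k :=
  (∫ b, L b ∂π)⁻¹ • ∫ b, L b • b ∂π

theorem measurable_weightedMean (π : Measure (E k)) [SFinite π] {L : 𝓧 → E k → ℝ}
    (hL : Measurable (Function.uncurry L)) : Measurable fun x => weightedMean π (L x) := by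
  have h1 : StronglyMeasurable fun x => ∫ b, L x b ∂π :=
    StronglyMeasurable.integral_prod_right (f := L) hL.stronglyMeasurable
  have h2 : StronglyMeasurable fun x => ∫ b, L x b • b ∂π :=
    StronglyMeasurable.integral_prod_right (f := fun x b => L x b • b)
      (hL.smul measurable_snd).stronglyMeasurable
  exact h1.measurable.inv.smul h2.measurable

theorem measurable_posteriorMean (π : Measure (E k)) [IsFiniteMeasure π] (P : Measure Ω)
    [IsFiniteMeasure P] (D : E k → Ω → 𝓧) : Measurable (posteriorMean π P D) :=
  (StronglyMeasurable.integral_condDistrib (f := fun p : 𝓧 × E k => p.2)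
    measurable_snd.stronglyMeasurable).measurable

variable {π : Measure (E k)} [IsProbabilityMeasure π] {P : Measure Ω} [IsProbabilityMeasure P]
  {D : E k → Ω → 𝓧} {μ : Measure 𝓧} [SFinite μ] {L : 𝓧 → E k → ℝ}

/-- Disintegration of the joint law of data and parameter along the data, in terms of the
likelihood `L`. -/
theorem lintegral_data_param (hD : Measurable fun p : E k × Ω => D p.1 p.2)
    (hL : Measurable (Function.uncurry L))
    (hlaw : ∀ b, P.map (D b) = μ.withDensity fun x => ENNReal.ofReal (L x b))
    {f : 𝓧 × E k → ℝ≥0∞} (hf : Measurable f) :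
    ∫⁻ p, f (D p.1 p.2, p.1) ∂(π.prod P) =
      ∫⁻ x, ∫⁻ b, ENNReal.ofReal (L x b) * f (x, b) ∂π ∂μ := by
  have hfD : Measurable fun p : E k × Ω => f (D p.1 p.2, p.1) :=
    hf.comp (hD.prodMk measurable_fst)
  rw [lintegral_prod _ hfD.aemeasurable,
    lintegral_lintegral_swap (f := fun x b => ENNReal.ofReal (L x b) * f (x, b))]
  · refine lintegral_congr fun b => ?_
    have hDb : Measurable (D b) := hD.comp measurable_prodMk_left
    have hfb : Measurable fun x => f (x, b) := hf.comp measurable_prodMk_right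
    rw [← lintegral_map (f := fun x => f (x, b)) hfb hDb, hlaw b,
      lintegral_withDensity_eq_lintegral_mul _ _ hfb]
    · rfl
    · exact (hL.comp measurable_prodMk_right).ennreal_ofReal
  · exact (hL.ennreal_ofReal.mul hf).aemeasurable

set_option maxHeartbeats 1000000 in
/-- Bayes' rule: the posterior has density proportional to the likelihood. The exceptional set is
null for `μ`, not merely for the law of the data under the prior. -/
theorem posteriorMean_ae_eq (hD : Measurable fun p : E k × Ω => D p.1 p.2)
    (hL : Measurable (Function.uncurry L)) (hpos : ∀ x b, 0 < L x b)
    (hlaw : ∀ b, P.map (D b) = μ.withDensity fun x => ENNReal.ofReal (L x b)) :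
    posteriorMean π P D =ᵐ[μ] fun x => weightedMean π (L x) := by
  set Z : 𝓧 → ℝ≥0∞ := fun x => ∫⁻ b, ENNReal.ofReal (L x b) ∂π with hZ
  have hZm : Measurable Z := Measurable.lintegral_prod_right hL.ennreal_ofReal
  have hLx : ∀ x, Measurable (L x) := fun x => hL.comp measurable_prodMk_left
  have hZ0 : ∀ x, Z x ≠ 0 := by
    intro x h
    rw [hZ, lintegral_eq_zero_iff (hLx x).ennreal_ofReal] at h
    obtain ⟨b, hb⟩ := h.exists
    exact (ENNReal.ofReal_pos.2 (hpos x b)).ne' hb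
  -- The marginal density integrates to one, so no integrability of `L x` has to be assumed.
  have hZtop : ∀ᵐ x ∂μ, Z x ≠ ⊤ := by
    have h1 : ∫⁻ x, Z x ∂μ = 1 := by
      have := lintegral_data_param (π := π) hD hL hlaw (f := fun _ => 1) measurable_const
      simpa using this.symm
    filter_upwards [ae_lt_top hZm (by simp [h1])] with x hx using hx.ne
  have hmapD : (π.prod P).map (fun p => D p.1 p.2) = μ.withDensity Z := by
    ext s hs
    rw [withDensity_apply _ hs, ← lintegral_indicator_one hs,
      lintegral_map (measurable_one.indicator hs) hD,
      lintegral_data_param (f := fun p => s.indicator 1 p.1) hD hL hlaw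
        ((measurable_one.indicator hs).comp measurable_fst), ← lintegral_indicator hs]
    refine lintegral_congr fun x => ?_
    by_cases hx : x ∈ s <;> simp [hx, hZ]
  set κd : 𝓧 → E k → ℝ≥0∞ := fun x b => (Z x)⁻¹ * ENNReal.ofReal (L x b) with hκd
  have hκdm : Measurable (Function.uncurry κd) :=
    (hZm.comp measurable_fst).inv.mul hL.ennreal_ofReal
  have hκdx : ∀ x, Measurable (κd x) := fun x => hκdm.comp measurable_prodMk_left
  set κ : Kernel 𝓧 (E k) := Kernel.withDensity (Kernel.const 𝓧 π) κd with hκ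
  have hκx : ∀ x, κ x = π.withDensity (κd x) := fun x => by
    rw [hκ, Kernel.withDensity_apply _ hκdm, Kernel.const_apply]
  have : IsFiniteKernel κ := by
    refine ⟨⟨1, ENNReal.one_lt_top, fun x => ?_⟩⟩
    rw [hκx, withDensity_apply _ MeasurableSet.univ, Measure.restrict_univ, hκd,
      lintegral_const_mul _ (hLx x).ennreal_ofReal]
    exact ENNReal.inv_mul_le_one _
  have key : (π.prod P).map (fun p => (D p.1 p.2, p.1)) =
      (π.prod P).map (fun p => D p.1 p.2) ⊗ₘ κ := by
    refine Measure.ext_of_lintegral _ fun f hf => ?_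
    have hm : Measurable fun x => ∫⁻ b, f (x, b) ∂(κ x) :=
      Measurable.lintegral_kernel_prod_right hf
    rw [lintegral_map hf (hD.prodMk measurable_fst), lintegral_data_param hD hL hlaw hf,
      Measure.lintegral_compProd hf, hmapD, lintegral_withDensity_eq_lintegral_mul _ hZm hm]
    refine lintegral_congr_ae ?_
    filter_upwards [hZtop] with x hx
    have hfx : Measurable fun b => f (x, b) := hf.comp measurable_prodMk_left
    rw [Pi.mul_apply, hκx, lintegral_withDensity_eq_lintegral_mul _ (hκdx x) hfx,
      ← lintegral_const_mul]
    · refine lintegral_congr fun b => ?_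
      simp only [Pi.mul_apply, hκd]
      rw [← mul_assoc, ← mul_assoc, ENNReal.mul_inv_cancel (hZ0 x) hx, one_mul]
    · exact (hκdx x).mul hfx
  have hae := condDistrib_ae_eq_of_measure_eq_compProd_of_measurable
    (μ := π.prod P) (Y := fun p : E k × Ω => p.1) hD measurable_fst key
  rw [hmapD] at hae
  have hac : μ ≪ μ.withDensity Z :=
    withDensity_absolutelyContinuous' hZm.aemeasurable (Filter.Eventually.of_forall hZ0)
  filter_upwards [hac.ae_le hae, hZtop] with x hx hxt
  have hLi : ∫ b, L x b ∂π = (Z x).toReal := by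
    rw [integral_eq_lintegral_of_nonneg_ae (Filter.Eventually.of_forall fun b => (hpos x b).le)
      (hLx x).aestronglyMeasurable]
  rw [posteriorMean, hx, hκx, integral_withDensity_eq_integral_toReal_smul (hκdx x)]
  · rw [weightedMean, hLi, ← integral_smul]
    refine integral_congr_ae (Filter.Eventually.of_forall fun b => ?_)
    simp only [hκd]
    rw [ENNReal.toReal_mul, ENNReal.toReal_inv, ENNReal.toReal_ofReal (hpos x b).le, mul_smul]
  · refine Filter.Eventually.of_forall fun b => ?_
    exact ENNReal.mul_lt_top (ENNReal.inv_lt_top.2 (pos_iff_ne_zero.2 (hZ0 x)))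
      ENNReal.ofReal_lt_top

/-- The mean of a probability measure minimises the expected squared distance. If the measure has
no second moment, the right-hand side is infinite. -/
theorem lintegral_enorm_mean_sub_sq_le (ρ : Measure (E k)) [IsProbabilityMeasure ρ] (a : E k) :
    ∫⁻ b, ‖(∫ x, x ∂ρ) - b‖ₑ ^ 2 ∂ρ ≤ ∫⁻ b, ‖a - b‖ₑ ^ 2 ∂ρ := by
  by_cases htop : ∫⁻ b, ‖a - b‖ₑ ^ 2 ∂ρ = ⊤
  · rw [htop]; exact le_top
  have conv : ∀ v : E k, ‖v‖ₑ ^ 2 = ENNReal.ofReal (‖v‖ ^ 2) := fun v => by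
    rw [ENNReal.ofReal_pow (norm_nonneg _), ofReal_norm]
  have hmem : MemLp (fun b => a - b) 2 ρ := by
    refine ⟨by fun_prop, ?_⟩
    rw [eLpNorm_lt_top_iff_lintegral_rpow_enorm_lt_top (by norm_num) (by norm_num)]
    simpa [lt_top_iff_ne_top] using htop
  have hid : MemLp (fun b : E k => b) 2 ρ := by
    have := (memLp_const a).sub hmem
    rwa [show ((fun _ => a) - fun b => a - b : E k → E k) = fun b => b by ext1; simp] at this
  have hint : Integrable (fun b : E k => b) ρ := hid.integrable (by norm_num)
  have hsq : ∀ v : E k, Integrable (fun b => ‖v - b‖ ^ 2) ρ := fun v =>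
    ((memLp_const v).sub hid).integrable_norm_pow (by norm_num)
  simp_rw [conv]
  have hnn : ∀ v : E k, 0 ≤ᵐ[ρ] fun b => ‖v - b‖ ^ 2 := fun v =>
    Filter.Eventually.of_forall fun _ => sq_nonneg _
  rw [← ofReal_integral_eq_lintegral_ofReal (hsq _) (hnn _),
    ← ofReal_integral_eq_lintegral_ofReal (hsq _) (hnn _)]
  refine ENNReal.ofReal_le_ofReal ?_
  set m := ∫ x, x ∂ρ with hm
  have hmb : Integrable (fun b => m - b) ρ := (integrable_const m).sub hint
  have h0 : ∫ b, (m - b) ∂ρ = 0 := by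
    rw [integral_sub (integrable_const m) hint, integral_const, probReal_univ, one_smul, ← hm,
      sub_self]
  clear_value m
  have hexp : ∀ b, ‖a - b‖ ^ 2 = ‖a - m‖ ^ 2 + 2 * inner ℝ (a - m) (m - b) + ‖m - b‖ ^ 2 := by
    intro b
    rw [← norm_add_sq_real, sub_add_sub_cancel]
  have hin : Integrable (fun b => inner ℝ (a - m) (m - b)) ρ := hmb.const_inner _
  have hlin : Integrable (fun b => ‖a - m‖ ^ 2 + 2 * inner ℝ (a - m) (m - b)) ρ :=
    (integrable_const _).add (hin.const_mul 2)
  rw [integral_congr_ae (Filter.Eventually.of_forall hexp), integral_add hlin (hsq m),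
    integral_add (integrable_const _) (hin.const_mul 2), integral_const_mul,
    integral_inner hmb, h0, inner_zero_right, mul_zero, add_zero, integral_const, probReal_univ,
    one_smul]
  exact le_add_of_nonneg_left (sq_nonneg _)

/-- Bayes optimality of the posterior mean for squared error, among all measurable estimators. -/
theorem lintegral_sqRisk_posteriorMean_le (hD : Measurable fun p : E k × Ω => D p.1 p.2)
    {f : 𝓧 → E k} (hf : Measurable f) :
    ∫⁻ b, sqRisk P D (posteriorMean π P D) b ∂π ≤ ∫⁻ b, sqRisk P D f b ∂π := by
  have key : ∀ g : 𝓧 → E k, Measurable g → ∫⁻ b, sqRisk P D g b ∂π =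
      ∫⁻ x, ∫⁻ b, ‖g x - b‖ₑ ^ 2 ∂(condDistrib (fun p : E k × Ω => p.1)
        (fun p : E k × Ω => D p.1 p.2) (π.prod P) x)
        ∂((π.prod P).map fun p => D p.1 p.2) := by
    intro g hg
    have hh : Measurable fun q : 𝓧 × E k => ‖g q.1 - q.2‖ₑ ^ 2 := by fun_prop
    rw [← Measure.lintegral_compProd hh, compProd_map_condDistrib (by fun_prop),
      lintegral_map hh (hD.prodMk measurable_fst), lintegral_prod]
    · rfl
    · exact (hh.comp (hD.prodMk measurable_fst)).aemeasurable
  rw [key _ (measurable_posteriorMean _ _ _), key _ hf]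
  exact lintegral_mono fun x => lintegral_enorm_mean_sub_sq_le _ _

end Dominated

/-! ### Translations of the standard Gaussian measure and Gaussian posteriors -/

section Gaussian

variable {n : ℕ}

/-- The likelihood ratio of `N(h, I)` with respect to `N(0, I)`. -/
noncomputable def shiftDensity (h x : E n) : ℝ := Real.exp (inner ℝ h x - ‖h‖ ^ 2 / 2)

theorem shiftDensity_pos (h x : E n) : 0 < shiftDensity h x := Real.exp_pos _

theorem measurable_shiftDensity (h : E n) : Measurable (shiftDensity h) := by
  unfold shiftDensity; fun_prop

theorem integral_cexp_stdGaussian (h t : E n) :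
    ∫ x, Complex.exp (((inner ℝ h x : ℝ) : ℂ) + (inner ℝ x t : ℝ) * Complex.I) ∂(stdGaussian (E n)) =
      Complex.exp (∑ i, ((h i : ℂ) + t i * Complex.I) ^ 2 / 2) := by
  rw [← map_pi_eq_stdGaussian, integral_map (by fun_prop) (by fun_prop)]
  have : ∀ x : Fin n → ℝ, Complex.exp (((inner ℝ h (WithLp.toLp 2 x) : ℝ) : ℂ) +
      (inner ℝ (WithLp.toLp 2 x) t : ℝ) * Complex.I) =
      ∏ i, Complex.exp (((h i : ℂ) + t i * Complex.I) * (x i : ℝ)) := by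
    intro x
    rw [← Complex.exp_sum]
    congr 1
    simp only [PiLp.inner_apply, RCLike.inner_apply, conj_trivial, Complex.ofReal_sum,
      Complex.ofReal_mul, Finset.sum_mul, ← Finset.sum_add_distrib]
    exact Finset.sum_congr rfl fun i _ => by ring
  simp_rw [this]
  rw [integral_fintype_prod_eq_prod
    (f := fun i x => Complex.exp (((h i : ℂ) + t i * Complex.I) * (x : ℝ))), Complex.exp_sum]
  refine Finset.prod_congr rfl fun i _ => ?_
  have := complexMGF_id_gaussianReal (μ := 0) (v := 1) ((h i : ℂ) + t i * Complex.I)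
  simp only [complexMGF, id] at this
  rw [this]
  simp

theorem integrable_shiftDensity (h : E n) : Integrable (shiftDensity h) (stdGaussian (E n)) := by
  have h1 : Integrable (fun x : E n => Real.exp (inner ℝ h x)) (stdGaussian (E n)) := by
    rw [← map_pi_eq_stdGaussian, integrable_map_measure (by fun_prop) (by fun_prop)]
    have := Integrable.fintype_prod (μ := fun _ : Fin n => gaussianReal 0 1)
      (f := fun i x => Real.exp (h i * x)) fun i => integrable_exp_mul_gaussianReal (h i)
    refine this.congr (Filter.Eventually.of_forall fun x => ?_)
    simp only [Function.comp, PiLp.inner_apply, RCLike.inner_apply, conj_trivial, Real.exp_sum]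
    exact Finset.prod_congr rfl fun i _ => by rw [mul_comm]
  unfold shiftDensity
  simp_rw [Real.exp_sub]
  exact h1.div_const _

/-- The Cameron–Martin formula in finite dimension. -/
theorem map_add_stdGaussian (h : E n) :
    (stdGaussian (E n)).map (fun x => h + x) =
      (stdGaussian (E n)).withDensity fun x => ENNReal.ofReal (shiftDensity h x) := by
  have hfin : IsFiniteMeasure
      ((stdGaussian (E n)).withDensity fun x => ENNReal.ofReal (shiftDensity h x)) :=
    isFiniteMeasure_withDensity_ofReal (integrable_shiftDensity h).2
  apply Measure.ext_of_charFun
  ext t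
  rw [charFun_apply, charFun_apply, integral_map (by fun_prop) (by fun_prop),
    integral_withDensity_eq_integral_toReal_smul (measurable_shiftDensity h).ennreal_ofReal
      (Filter.Eventually.of_forall fun _ => ENNReal.ofReal_lt_top)]
  have e1 : ∀ x : E n, Complex.exp (((inner ℝ (h + x) t : ℝ) : ℂ) * Complex.I) =
      Complex.exp ((inner ℝ h t : ℝ) * Complex.I) *
        Complex.exp (((inner ℝ (0 : E n) x : ℝ) : ℂ) + (inner ℝ x t : ℝ) * Complex.I) := by
    intro x
    rw [← Complex.exp_add, inner_add_left, inner_zero_left]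
    congr 1
    push_cast
    ring
  have e2 : ∀ x : E n, (ENNReal.ofReal (shiftDensity h x)).toReal •
      Complex.exp (((inner ℝ x t : ℝ) : ℂ) * Complex.I) =
      Complex.exp (-((‖h‖ ^ 2 / 2 : ℝ) : ℂ)) *
        Complex.exp (((inner ℝ h x : ℝ) : ℂ) + (inner ℝ x t : ℝ) * Complex.I) := by
    intro x
    rw [ENNReal.toReal_ofReal (shiftDensity_pos h x).le, shiftDensity, Complex.real_smul,
      Complex.ofReal_exp, ← Complex.exp_add, ← Complex.exp_add]
    congr 1
    push_cast
    ring
  simp_rw [e1, e2]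
  rw [integral_const_mul, integral_const_mul, integral_cexp_stdGaussian,
    integral_cexp_stdGaussian, ← Complex.exp_add, ← Complex.exp_add]
  congr 1
  rw [EuclideanSpace.real_norm_sq_eq]
  simp only [PiLp.inner_apply, RCLike.inner_apply, conj_trivial, PiLp.zero_apply]
  push_cast
  rw [Finset.sum_mul, ← Finset.sum_add_distrib, Finset.sum_div, ← Finset.sum_neg_distrib,
    ← Finset.sum_add_distrib]
  refine Finset.sum_congr rfl fun i _ => ?_
  ring_nf

theorem integral_shiftDensity_smul {F : Type*} [NormedAddCommGroup F] [NormedSpace ℝ F]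
    (h : E n) {f : E n → F} (hf : Continuous f) :
    ∫ x, shiftDensity h x • f x ∂(stdGaussian (E n)) = ∫ x, f (h + x) ∂(stdGaussian (E n)) := by
  rw [← integral_map (φ := fun x => h + x) (by fun_prop) hf.aestronglyMeasurable,
    map_add_stdGaussian,
    integral_withDensity_eq_integral_toReal_smul (measurable_shiftDensity h).ennreal_ofReal
      (Filter.Eventually.of_forall fun _ => ENNReal.ofReal_lt_top)]
  refine integral_congr_ae (Filter.Eventually.of_forall fun x => ?_)
  simp only
  rw [ENNReal.toReal_ofReal (shiftDensity_pos h x).le]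

theorem integral_odd_stdGaussian {f : E n → E n} (hf : ∀ x, f (-x) = -f x) :
    ∫ x, f x ∂(stdGaussian (E n)) = 0 := by
  have hmap := stdGaussian_map (LinearIsometryEquiv.neg ℝ (E := E n))
  have h1 : ∫ x, f x ∂(stdGaussian (E n)) = ∫ x, f (-x) ∂(stdGaussian (E n)) := by
    conv_lhs => rw [← hmap]
    exact (LinearIsometryEquiv.neg ℝ (E := E n)).toHomeomorph.measurableEmbedding.integral_map f
  simp_rw [hf, integral_neg] at h1
  rw [eq_neg_iff_add_eq_zero, ← two_smul ℝ] at h1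
  exact (smul_eq_zero.1 h1).resolve_left two_ne_zero

/-- The likelihood of `b` in a Gaussian shift experiment, up to a factor not depending on `b`:
`w` is the information-weighted observation and `M` the information matrix. -/
noncomputable def shiftLik (w : E n) (M : Mat n n) (b : E n) : ℝ :=
  Real.exp (inner ℝ b w - inner ℝ b (Matrix.toEuclideanLin M b) / 2)

theorem shiftLik_pos (w : E n) (M : Mat n n) (b : E n) : 0 < shiftLik w M b := Real.exp_pos _

/-- The prior is `N(0, s² I)`, and the posterior mean `s h` solves `(M + s⁻² I) (s h) = w`, written
so that `s = 0` is allowed. Completing the square turns the likelihood at `s g` into the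
Cameron–Martin density of the shift by `h` times an even function of `g - h`. -/
theorem weightedMean_gaussian_shiftLik {M : Mat n n} (hM : M.PosSemidef) {s : ℝ} {w h : E n}
    (hw : s • w = s ^ 2 • Matrix.toEuclideanLin M h + h) :
    weightedMean ((stdGaussian (E n)).map fun g => s • g) (shiftLik w M) = s • h := by
  set q : E n → ℝ := fun u => Real.exp (-(s ^ 2 * inner ℝ u (Matrix.toEuclideanLin M u) / 2)) with hq
  have hcM : Continuous (Matrix.toEuclideanLin M) := LinearMap.continuous_of_finiteDimensional _
  have hqc : Continuous q := by rw [hq]; fun_prop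
  have hpos : ∀ u : E n, 0 ≤ inner ℝ u (Matrix.toEuclideanLin M u) := fun u => by
    have := (Matrix.isPositive_toEuclideanLin_iff.2 hM).inner_nonneg_right u
    simpa using this
  have hsymm : ∀ u v : E n, inner ℝ u (Matrix.toEuclideanLin M v) =
      inner ℝ v (Matrix.toEuclideanLin M u) := fun u v => by
    rw [real_inner_comm]
    exact (Matrix.isPositive_toEuclideanLin_iff.2 hM).isSymmetric v u
  have hq1 : ∀ u, ‖q u‖ ≤ 1 := fun u => by
    rw [hq, Real.norm_eq_abs, Real.abs_exp, Real.exp_le_one_iff, neg_nonpos]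
    have := hpos u
    positivity
  set C : ℝ := Real.exp (‖h‖ ^ 2 / 2 + s ^ 2 * inner ℝ h (Matrix.toEuclideanLin M h) / 2) with hC
  have hlik : ∀ g, shiftLik w M (s • g) = shiftDensity h g • (C * q (g - h)) := by
    intro g
    rw [shiftLik, shiftDensity, hC, hq, smul_eq_mul, ← Real.exp_add, ← Real.exp_add]
    congr 1
    have h1 : inner ℝ (s • g) w = s ^ 2 * inner ℝ g (Matrix.toEuclideanLin M h) + inner ℝ g h := by
      rw [real_inner_smul_left, ← real_inner_smul_right, hw, inner_add_right, real_inner_smul_right]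
    rw [h1, map_smul, map_sub, real_inner_smul_left, real_inner_smul_right, inner_sub_left, inner_sub_right,
      inner_sub_right, hsymm h g, real_inner_comm g h]
    ring
  have hqi : Integrable q (stdGaussian (E n)) :=
    (integrable_const (1 : ℝ)).mono' hqc.aestronglyMeasurable (Filter.Eventually.of_forall hq1)
  have hqgi : Integrable (fun g => q g • g) (stdGaussian (E n)) := by
    refine (IsGaussian.integrable_id (μ := stdGaussian (E n))).bdd_smul 1
      hqc.aestronglyMeasurable (Filter.Eventually.of_forall hq1)
  have hq0 : 0 < ∫ g, q g ∂(stdGaussian (E n)) := integral_exp_pos hqi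
  have hsm : Measurable fun g : E n => s • g := by fun_prop
  have hlc : Continuous (shiftLik w M) := by unfold shiftLik; fun_prop
  have hlb : Continuous fun b => shiftLik w M b • b := hlc.smul continuous_id
  rw [weightedMean, integral_map hsm.aemeasurable hlc.aestronglyMeasurable,
    integral_map hsm.aemeasurable hlb.aestronglyMeasurable]
  simp_rw [hlik]
  have hodd : ∫ g, q g • g ∂(stdGaussian (E n)) = 0 := integral_odd_stdGaussian fun g => by
    simp [hq]
  have i1 := integral_shiftDensity_smul h (f := fun g => C * q (g - h)) (by fun_prop)
  have i2 := integral_shiftDensity_smul h (f := fun g => (C * q (g - h)) • s • g) (by fun_prop)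
  simp_rw [smul_assoc]
  rw [i1, i2]
  simp only [add_sub_cancel_left]
  rw [integral_const_mul]
  have hsplit : ∀ g, (C * q g) • s • (h + g) = (C * s) • (q g • h + q g • g) := fun g => by
    module
  simp_rw [hsplit]
  rw [integral_smul, integral_add (hqi.smul_const h) hqgi, hodd, add_zero, integral_smul_const,
    smul_smul, smul_smul]
  congr 1
  have : C ≠ 0 := (Real.exp_pos _).ne'
  field_simp

end Gaussian

/-! ### Measurability of the matrix square root -/

section Sqrt

open scoped MatrixOrder

theorem measurableSet_matrix_nonneg (m : ℕ) : MeasurableSet {S : Mat m m | 0 ≤ S} := by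
  have : {S : Mat m m | 0 ≤ S} =
      {S | Sᵀ = S} ∩ ⋂ x : Fin m → ℝ, {S | 0 ≤ x ⬝ᵥ (S *ᵥ x)} := by
    ext S
    simp [Matrix.nonneg_iff_posSemidef, Matrix.posSemidef_iff_dotProduct_mulVec,
      Matrix.IsHermitian]
  rw [this]
  refine IsClosed.measurableSet (IsClosed.inter ?_ (isClosed_iInter fun x => ?_))
  · exact isClosed_eq (by fun_prop) continuous_id
  · exact isClosed_le continuous_const (by fun_prop)

theorem measurableSet_posDef (m : ℕ) : MeasurableSet {S : Mat m m | S.PosDef} := by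
  have : {S : Mat m m | S.PosDef} = {S | 0 ≤ S} ∩ {S | S.det = 0}ᶜ := by
    ext S
    constructor
    · exact fun h => ⟨Matrix.nonneg_iff_posSemidef.2 h.posSemidef, h.det_pos.ne'⟩
    · rintro ⟨h1, h2⟩
      exact (Matrix.nonneg_iff_posSemidef.1 h1).posDef_iff_isUnit.2
        ((Matrix.isUnit_iff_isUnit_det _).2 (isUnit_iff_ne_zero.2 h2))
  rw [this]
  exact (measurableSet_matrix_nonneg m).inter
    (isClosed_eq (by fun_prop) continuous_const).measurableSet.compl

/-- On positive semidefinite matrices, squaring is injective, so by the Lusin–Souslin theorem its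
inverse is measurable; outside them `CFC.sqrt` is `0`. -/
theorem measurable_matrixSqrt (m : ℕ) : Measurable fun S : Mat m m => CFC.sqrt S := by
  have : StandardBorelSpace (Mat m m) :=
    inferInstanceAs (StandardBorelSpace (Fin m → Fin m → ℝ))
  have : StandardBorelSpace {S : Mat m m // 0 ≤ S} :=
    (measurableSet_matrix_nonneg m).standardBorel
  have hsq : Measurable fun T : {S : Mat m m // 0 ≤ S} => (T : Mat m m) * (T : Mat m m) :=
    (show Continuous fun T : Mat m m => T * T by fun_prop).measurable.comp measurable_subtype_coe
  have hinj : Function.Injective fun T : {S : Mat m m // 0 ≤ S} => (T : Mat m m) * (T : Mat m m) := by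
    intro T T' h
    have h' : (T : Mat m m) * (T : Mat m m) = (T' : Mat m m) * (T' : Mat m m) := h
    ext1
    rw [← CFC.sqrt_mul_self (T : Mat m m) T.2, h', CFC.sqrt_mul_self (T' : Mat m m) T'.2]
  have hemb := hsq.measurableEmbedding hinj
  have heq : (fun S : Mat m m => CFC.sqrt S) = Function.extend
      (fun T : {S : Mat m m // 0 ≤ S} => (T : Mat m m) * (T : Mat m m)) Subtype.val
      (fun _ => 0) := by
    ext1 S
    by_cases hS : 0 ≤ S
    · have h1 := hinj.extend_apply (Subtype.val : {S : Mat m m // 0 ≤ S} → Mat m m) (fun _ => 0)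
        ⟨CFC.sqrt S, CFC.sqrt_nonneg S⟩
      simp only [CFC.sqrt_mul_sqrt_self S hS] at h1
      exact h1.symm
    · rw [Function.extend_apply', CFC.sqrt_of_not_nonneg hS]
      rintro ⟨T, rfl⟩
      refine hS ?_
      have hT := Matrix.nonneg_iff_posSemidef.1 T.2
      have := Matrix.posSemidef_conjTranspose_mul_self (T : Mat m m)
      rw [hT.1] at this
      exact Matrix.nonneg_iff_posSemidef.2 this
  rw [heq]
  exact hemb.measurable_extend measurable_subtype_coe measurable_const

end Sqrt

theorem measurable_toEuclideanLin {Ω : Type*} [MeasurableSpace Ω] {k l : ℕ}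
    {A : Ω → Mat k l} {v : Ω → E l} (hA : Measurable A) (hv : Measurable v) :
    Measurable fun ω => Matrix.toEuclideanLin (A ω) (v ω) := by
  simp only [Matrix.toLpLin_apply]
  refine (WithLp.measurable_toLp 2 _).comp (measurable_pi_iff.2 fun i => ?_)
  change Measurable fun ω => ∑ j, A ω i j * v ω j
  refine Finset.measurable_sum _ fun j _ => ?_
  have h1 : Measurable fun ω => A ω i j := (measurable_pi_apply j).comp ((measurable_pi_apply i).comp hA)
  have h2 : Measurable fun ω => v ω j :=
    (measurable_pi_apply j).comp ((WithLp.measurable_ofLp 2 _).comp hv)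
  exact h1.mul h2

theorem measurable_matrix_inv (m : ℕ) : Measurable fun S : Mat m m => S⁻¹ := by
  simp only [Matrix.inv_def, Ring.inverse_eq_inv']
  have h1 : Measurable fun S : Mat m m => S.det :=
    (show Continuous fun S : Mat m m => S.det by fun_prop).measurable
  have h2 : Measurable fun S : Mat m m => S.adjugate :=
    (show Continuous fun S : Mat m m => S.adjugate by fun_prop).measurable
  exact h1.inv.smul h2

/-! ### The Gaussian design has full column rank -/

theorem absolutelyContinuous_pi {α : Type*} [MeasurableSpace α] {n : ℕ} {μ ν : Measure α}
    [SigmaFinite μ] [SigmaFinite ν] (h : μ ≪ ν) :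
    Measure.pi (fun _ : Fin n => μ) ≪ Measure.pi (fun _ : Fin n => ν) := by
  induction n with
  | zero => rw [Measure.pi_of_empty, Measure.pi_of_empty]
  | succ n ih =>
    have h1 := (measurePreserving_piFinSuccAbove (fun _ : Fin (n + 1) => μ) 0).symm
    have h2 := (measurePreserving_piFinSuccAbove (fun _ : Fin (n + 1) => ν) 0).symm
    rw [← h1.map_eq, ← h2.map_eq]
    exact (h.prod ih).map (MeasurableEquiv.measurable _)

/-- Moving any matrix along the direction of the identity block makes its top square block
singular only finitely often, so Lebesgue-almost every matrix has an invertible top block. -/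
theorem ae_gram_posDef {n d : ℕ} (hdn : d ≤ n) :
    ∀ᵐ X ∂(gaussianDesign n d), (Xᵀ * X).PosDef := by
  let B : Mat n d → Mat d d := fun X => X.submatrix (Fin.castLE hdn) id
  have hBc : Continuous B := continuous_id.matrix_submatrix _ _
  let J : Mat n d := Matrix.of fun i j => if i = Fin.castLE hdn j then 1 else 0
  have hJ : B J = 1 := by
    ext i j
    simp [B, J, Matrix.one_apply, Fin.ext_iff]
  let V := Fin n → Fin d → ℝ
  let lam : Measure V := Measure.pi fun _ => Measure.pi fun _ => volume
  have hac : gaussianDesign n d ≪ lam :=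
    absolutelyContinuous_pi (absolutelyContinuous_pi (gaussianReal_absolutelyContinuous 0 one_ne_zero))
  let L : ℝ →ₗ[ℝ] V := LinearMap.toSpanSingleton ℝ V J
  have hs : MeasurableSet {X : V | (B X).det ≠ 0} :=
    ((isClosed_singleton (x := (0 : ℝ))).preimage
      (show Continuous fun X : V => (B X).det from hBc.matrix_det)).measurableSet.compl
  have hdet : ∀ᵐ X ∂lam, X ∈ {X : V | (B X).det ≠ 0} := by
    refine ae_mem_of_ae_add_linearMap_mem L volume lam hs fun X => ?_
    have hfin : Set.Finite {t : ℝ | (B (X + L t)).det = 0} := by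
      refine ((-(B X)).charpoly.roots.toFinset.finite_toSet).subset fun t ht => ?_
      have : B (X + L t) = Matrix.scalar (Fin d) t - -(B X) := by
        have h1 : B (X + L t) = B X + t • B J := rfl
        rw [h1, hJ, Matrix.scalar_apply, ← Matrix.smul_one_eq_diagonal]
        abel
      rw [Set.mem_ofPred_eq, this, ← Matrix.eval_charpoly] at ht
      simpa [(Matrix.charpoly_monic _).ne_zero] using ht
    have := (hfin.measure_zero volume)
    rw [ae_iff]
    simpa using this
  filter_upwards [hac.ae_le hdet] with X hX
  have hX' : (B X).det ≠ 0 := hX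
  have hinj : Function.Injective X.mulVec := by
    intro v w hvw
    have h1 : (B X).mulVec v = (B X).mulVec w := by
      ext i
      exact congrFun hvw (Fin.castLE hdn i)
    exact Matrix.mulVec_injective_of_isUnit
      ((Matrix.isUnit_iff_isUnit_det _).2 (isUnit_iff_ne_zero.2 hX')) h1
  exact Matrix.PosDef.conjTranspose_mul_self X hinj

/-! ### Orthogonal invariance -/

theorem toEuclideanLin_mul_apply {k l m : ℕ} (A : Mat k l) (B : Mat l m) (v : E m) :
    Matrix.toEuclideanLin (A * B) v = Matrix.toEuclideanLin A (Matrix.toEuclideanLin B v) := by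
  simp only [Matrix.toLpLin_apply, Matrix.mulVec_mulVec]

theorem toEuclideanLin_one_apply {k : ℕ} (v : E k) :
    Matrix.toEuclideanLin (1 : Mat k k) v = v := by
  simp only [Matrix.toLpLin_apply, Matrix.one_mulVec]

theorem inner_toEuclideanLin_left {k l : ℕ} (A : Mat k l) (v : E l) (w : E k) :
    inner ℝ (Matrix.toEuclideanLin A v) w = inner ℝ v (Matrix.toEuclideanLin Aᵀ w) := by
  have h := Matrix.toEuclideanLin_conjTranspose_eq_adjoint A
  rw [Matrix.conjTranspose_eq_transpose_of_trivial] at h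
  rw [h, LinearMap.adjoint_inner_right]

theorem transpose_mul_self_of_mem {k : ℕ} {U : Mat k k}
    (hU : U ∈ Matrix.orthogonalGroup (Fin k) ℝ) : Uᵀ * U = 1 :=
  (Matrix.mem_orthogonalGroup_iff' (Fin k) ℝ).1 hU

theorem mul_transpose_self_of_mem {k : ℕ} {U : Mat k k}
    (hU : U ∈ Matrix.orthogonalGroup (Fin k) ℝ) : U * Uᵀ = 1 :=
  (Matrix.mem_orthogonalGroup_iff (Fin k) ℝ).1 hU

theorem transpose_mem {k : ℕ} {U : Mat k k}
    (hU : U ∈ Matrix.orthogonalGroup (Fin k) ℝ) : Uᵀ ∈ Matrix.orthogonalGroup (Fin k) ℝ := by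
  rw [Matrix.mem_orthogonalGroup_iff]
  exact transpose_mul_self_of_mem hU

theorem norm_toEuclideanLin_of_mem {k : ℕ} {U : Mat k k}
    (hU : U ∈ Matrix.orthogonalGroup (Fin k) ℝ) (v : E k) :
    ‖Matrix.toEuclideanLin U v‖ = ‖v‖ := by
  rw [← sq_eq_sq₀ (norm_nonneg _) (norm_nonneg _), ← real_inner_self_eq_norm_sq,
    inner_toEuclideanLin_left, ← toEuclideanLin_mul_apply, transpose_mul_self_of_mem hU,
    toEuclideanLin_one_apply, real_inner_self_eq_norm_sq]

/-- The linear isometry of `ℝᵏ` given by an orthogonal matrix. -/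
noncomputable def orthIsometry {k : ℕ} (U : Mat k k) (hU : U ∈ Matrix.orthogonalGroup (Fin k) ℝ) :
    E k ≃ₗᵢ[ℝ] E k :=
  LinearIsometry.toLinearIsometryEquiv
    (⟨Matrix.toEuclideanLin U, norm_toEuclideanLin_of_mem hU⟩ : E k →ₗᵢ[ℝ] E k) rfl

theorem coe_orthIsometry {k : ℕ} (U : Mat k k) (hU : U ∈ Matrix.orthogonalGroup (Fin k) ℝ) :
    ⇑(orthIsometry U hU) = Matrix.toEuclideanLin U := rfl

/-- The orthogonal group acts transitively on spheres: a reflection does it. -/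
theorem exists_orthogonal_map_eq {k : ℕ} {v w : E k} (h : ‖v‖ = ‖w‖) :
    ∃ U ∈ Matrix.orthogonalGroup (Fin k) ℝ, Matrix.toEuclideanLin U v = w := by
  set R : E k ≃ₗᵢ[ℝ] E k := (ℝ ∙ (v - w))ᗮ.reflection
  have hR : Matrix.toEuclideanLin (Matrix.toEuclideanLin.symm R.toLinearEquiv.toLinearMap) =
      R.toLinearEquiv.toLinearMap := LinearEquiv.apply_symm_apply _ _
  set U : Mat k k := Matrix.toEuclideanLin.symm R.toLinearEquiv.toLinearMap
  have hRa : ∀ x, Matrix.toEuclideanLin U x = R x := fun x => by rw [hR]; rfl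
  refine ⟨U, ?_, ?_⟩
  · rw [Matrix.mem_orthogonalGroup_iff']
    apply Matrix.toEuclideanLin.injective
    refine LinearMap.ext fun x => ext_inner_left ℝ fun y => ?_
    rw [toEuclideanLin_mul_apply, ← inner_toEuclideanLin_left, hRa, hRa,
      toEuclideanLin_one_apply, R.inner_map_map]
  · rw [hRa]
    exact Submodule.reflection_sub h

/-- Each row of the design is a standard Gaussian vector, whose law is rotation invariant. -/
theorem map_gaussianDesign_mul {n d : ℕ} {U : Mat d d}
    (hU : U ∈ Matrix.orthogonalGroup (Fin d) ℝ) :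
    (gaussianDesign n d).map (fun X : Mat n d => X * U) = gaussianDesign n d := by
  set ρ : Measure (Fin d → ℝ) := Measure.pi fun _ => gaussianReal 0 1 with hρ
  have hρg : ρ = (stdGaussian (E d)).map WithLp.ofLp := by
    rw [← map_pi_eq_stdGaussian, Measure.map_map (by fun_prop) (by fun_prop)]
    exact Measure.map_id.symm
  have hVc : Measurable fun x : Fin d → ℝ => x ᵥ* U :=
    (show Continuous fun x : Fin d → ℝ => x ᵥ* U by fun_prop).measurable
  have hrow : ρ.map (fun x => x ᵥ* U) = ρ := by
    have h1 := stdGaussian_map (orthIsometry Uᵀ (transpose_mem hU))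
    rw [hρg, Measure.map_map hVc (by fun_prop)]
    conv_rhs => rw [← h1]
    rw [Measure.map_map (by fun_prop) (LinearIsometryEquiv.continuous _).measurable]
    congr 1
    ext1 x
    simp [coe_orthIsometry, Matrix.toLpLin_apply, Matrix.mulVec_transpose]
  have hsf : ∀ _ : Fin n, SigmaFinite (ρ.map fun x => x ᵥ* U) := fun _ => by
    rw [hrow]; infer_instance
  have := Measure.pi_map_pi (μ := fun _ : Fin n => ρ) (f := fun _ x => x ᵥ* U)
    fun _ => hVc.aemeasurable
  rw [hrow] at this
  exact this

theorem isProbabilityMeasure_sphereUniform {k : ℕ} (hk : 1 ≤ k) (c : ℝ) :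
    IsProbabilityMeasure (sphereUniform k c) := by
  have : Nonempty (Fin k) := ⟨⟨0, hk⟩⟩
  have hne : (volume : Measure (E k)).toSphere Set.univ ≠ 0 :=
    (Measure.measure_univ_eq_zero.not).2 (Measure.toSphere_ne_zero (volume : Measure (E k)))
  have := cond_isProbabilityMeasure hne
  unfold sphereUniform
  exact Measure.isProbabilityMeasure_map (by fun_prop)

theorem sphereUniform_ae_mem {k : ℕ} {c : ℝ} (hc : 0 ≤ c) :
    ∀ᵐ b ∂(sphereUniform k c), b ∈ Metric.sphere (0 : E k) c := by
  unfold sphereUniform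
  rw [ae_map_iff (p := fun b => b ∈ Metric.sphere (0 : E k) c) (by fun_prop)
    Metric.isClosed_sphere.measurableSet]
  refine Filter.Eventually.of_forall fun u => ?_
  simp [norm_smul, abs_of_nonneg hc]

open scoped Pointwise in
theorem map_sphereUniform {k : ℕ} (c : ℝ) {U : Mat k k}
    (hU : U ∈ Matrix.orthogonalGroup (Fin k) ℝ) :
    (sphereUniform k c).map (Matrix.toEuclideanLin U) = sphereUniform k c := by
  set R := orthIsometry U hU with hR
  let R' : Metric.sphere (0 : E k) 1 → Metric.sphere (0 : E k) 1 := fun u =>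
    ⟨R u, by simp⟩
  have hR'm : Measurable R' :=
    ((LinearIsometryEquiv.continuous R).measurable.comp measurable_subtype_coe).subtype_mk
  have hsph : ((volume : Measure (E k)).toSphere).map R' = (volume : Measure (E k)).toSphere := by
    ext s hs
    rw [Measure.map_apply hR'm hs, Measure.toSphere_apply' _ (hR'm hs),
      Measure.toSphere_apply' _ hs]
    congr 1
    have hset : Set.Ioo (0 : ℝ) 1 • (Subtype.val '' (R' ⁻¹' s)) =
        R ⁻¹' (Set.Ioo (0 : ℝ) 1 • (Subtype.val '' s)) := by
      ext x
      simp only [Set.mem_smul, Set.mem_image, Set.mem_preimage]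
      constructor
      · rintro ⟨r, hr, _, ⟨u, hu, rfl⟩, rfl⟩
        exact ⟨r, hr, _, ⟨R' u, hu, rfl⟩, by simp [R']⟩
      · rintro ⟨r, hr, _, ⟨u, hu, rfl⟩, hx⟩
        refine ⟨r, hr, R.symm u, ⟨⟨R.symm u, by simp⟩, ?_, rfl⟩, ?_⟩
        · simpa [R'] using hu
        · apply R.injective
          simp [hx]
    rw [hset]
    exact R.measurePreserving.measure_preimage_equiv (f := R.toHomeomorph.toMeasurableEquiv) _
  have hcond : ((volume : Measure (E k)).toSphere[|Set.univ]).map R' =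
      (volume : Measure (E k)).toSphere[|Set.univ] := by
    rw [ProbabilityTheory.cond, Measure.restrict_univ, Measure.map_smul, hsph]
  have hRm : Measurable (Matrix.toEuclideanLin U) := (LinearIsometryEquiv.continuous R).measurable
  unfold sphereUniform
  rw [Measure.map_map hRm (by fun_prop)]
  conv_rhs => rw [← hcond]
  rw [Measure.map_map (by fun_prop) hR'm]
  congr 1
  ext1 u
  simp [R', hR, coe_orthIsometry]

/-! ### The law of the reduced data -/

theorem measurable_transpose_mul_self (n d : ℕ) : Measurable fun X : Mat n d => Xᵀ * X :=
  (show Continuous fun X : Mat n d => Xᵀ * X by fun_prop).measurable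

theorem measurable_inv_gram (n d : ℕ) : Measurable fun X : Mat n d => (Xᵀ * X)⁻¹ :=
  (measurable_matrix_inv d).comp (measurable_transpose_mul_self n d)

theorem measurable_matrix_transpose (n d : ℕ) : Measurable fun X : Mat n d => Xᵀ :=
  (show Continuous fun X : Mat n d => Xᵀ by fun_prop).measurable

theorem measurable_linData {n d : ℕ} :
    Measurable fun p : E d × (Mat n d × E n) => linData p.1 p.2 := by
  unfold linData
  exact ((measurable_toEuclideanLin measurable_snd.fst measurable_fst).add
    measurable_snd.snd).prodMk measurable_snd.fst

theorem measurable_linData_right {n d : ℕ} (β : E d) :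
    Measurable (linData (n := n) β) :=
  ((measurable_toEuclideanLin measurable_fst measurable_const).add measurable_snd).prodMk
    measurable_fst

theorem measurable_seqData {m : ℕ} :
    Measurable fun p : E m × (Mat m m × E m) => seqData p.1 p.2 := by
  unfold seqData
  exact (measurable_fst.add (measurable_toEuclideanLin
    ((measurable_matrixSqrt m).comp measurable_snd.fst) measurable_snd.snd)).prodMk
      measurable_snd.fst

theorem measurable_seqData_right {m : ℕ} (θ : E m) :
    Measurable (seqData θ) := measurable_seqData.comp measurable_prodMk_left

theorem measurable_toSeq {n d : ℕ} : Measurable (toSeq (n := n) (d := d)) := by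
  have h : toSeq (n := n) (d := d) = fun x => (Matrix.toEuclideanLin (x.2ᵀ * x.2)⁻¹
      (Matrix.toEuclideanLin x.2ᵀ x.1), (x.2ᵀ * x.2)⁻¹) := by
    ext1 x
    rw [toSeq, toEuclideanLin_mul_apply]
  rw [h]
  have hi : Measurable fun x : E n × Mat n d => (x.2ᵀ * x.2)⁻¹ :=
    (measurable_inv_gram n d).comp measurable_snd
  exact (measurable_toEuclideanLin hi (measurable_toEuclideanLin
    ((measurable_matrix_transpose n d).comp measurable_snd) measurable_fst)).prodMk hi

instance isProbabilityMeasure_invGramLaw (n d : ℕ) : IsProbabilityMeasure (invGramLaw n d) :=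
  Measure.isProbabilityMeasure_map (measurable_inv_gram n d).aemeasurable

instance isProbabilityMeasure_seqNoise {m : ℕ} (ν : Measure (Mat m m)) [IsProbabilityMeasure ν] :
    IsProbabilityMeasure (seqNoise ν) := by
  unfold seqNoise; infer_instance

theorem inv_orthogonal_conj {d : ℕ} {U : Mat d d} (hU : U ∈ Matrix.orthogonalGroup (Fin d) ℝ)
    (M : Mat d d) : (U * M * Uᵀ)⁻¹ = U * M⁻¹ * Uᵀ := by
  rw [Matrix.mul_inv_rev, Matrix.mul_inv_rev,
    Matrix.inv_eq_right_inv (mul_transpose_self_of_mem hU),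
    Matrix.inv_eq_right_inv (transpose_mul_self_of_mem hU), Matrix.mul_assoc]

theorem isSeqCovLaw_invGramLaw {n d : ℕ} (hdn : d ≤ n) : IsSeqCovLaw (invGramLaw n d) where
  isProbabilityMeasure := inferInstance
  ae_posDef := by
    rw [invGramLaw, ae_map_iff (measurable_inv_gram n d).aemeasurable (measurableSet_posDef d)]
    filter_upwards [ae_gram_posDef hdn] with X hX using hX.inv
  invariant U hU := by
    have hUm : Measurable fun S : Mat d d => U * S * Uᵀ :=
      (show Continuous fun S : Mat d d => U * S * Uᵀ by fun_prop).measurable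
    have hXU : Measurable fun X : Mat n d => X * Uᵀ :=
      (show Continuous fun X : Mat n d => X * Uᵀ by fun_prop).measurable
    rw [invGramLaw, Measure.map_map hUm (measurable_inv_gram n d)]
    conv_rhs => rw [← map_gaussianDesign_mul (transpose_mem hU)]
    rw [Measure.map_map (measurable_inv_gram n d) hXU]
    congr 1
    ext1 X
    simp only [Function.comp]
    rw [← inv_orthogonal_conj hU, Matrix.transpose_mul, Matrix.transpose_transpose]
    simp only [Matrix.mul_assoc]

/-- The law of `A g`, for `g` standard Gaussian, depends on `A` only through `A Aᵀ`. -/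
theorem map_stdGaussian_eq_of_mul_transpose_eq {k l m : ℕ} {A : Mat m k} {B : Mat m l}
    (h : A * Aᵀ = B * Bᵀ) :
    (stdGaussian (E k)).map (Matrix.toEuclideanLin A) =
      (stdGaussian (E l)).map (Matrix.toEuclideanLin B) := by
  have hcf : ∀ (j : ℕ) (C : Mat m j) (t : E m),
      charFun ((stdGaussian (E j)).map (Matrix.toEuclideanLin C)) t =
        Complex.exp (-((inner ℝ t (Matrix.toEuclideanLin (C * Cᵀ) t) : ℝ) : ℂ) / 2) := by
    intro j C t
    have hm : Measurable (Matrix.toEuclideanLin C) :=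
      (LinearMap.continuous_of_finiteDimensional _).measurable
    rw [charFun_apply, integral_map hm.aemeasurable (by fun_prop)]
    simp_rw [inner_toEuclideanLin_left]
    rw [← charFun_apply, charFun_stdGaussian, toEuclideanLin_mul_apply]
    congr 2
    rw [real_inner_comm, inner_toEuclideanLin_left, real_inner_self_eq_norm_sq]
    push_cast
    rfl
  have hp : ∀ (j : ℕ) (C : Mat m j),
      IsProbabilityMeasure ((stdGaussian (E j)).map (Matrix.toEuclideanLin C)) := fun j C =>
    Measure.isProbabilityMeasure_map
      (LinearMap.continuous_of_finiteDimensional _).measurable.aemeasurable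
  have := hp k A
  have := hp l B
  apply Measure.ext_of_charFun
  ext t
  rw [hcf, hcf, h]

open scoped MatrixOrder in
/-- Conditionally on `X`, both sides are Gaussian with mean `β` and covariance `(XᵀX)⁻¹`. -/
theorem map_toSeq_linData {n d : ℕ} (hdn : d ≤ n) (β : E d) :
    (linNoise n d).map (fun ω => toSeq (linData β ω)) =
      (seqNoise (invGramLaw n d)).map (seqData β) := by
  refine Measure.ext_of_lintegral _ fun f hf => ?_
  have hTm : Measurable fun ω => toSeq (linData (n := n) β ω) :=
    measurable_toSeq.comp (measurable_linData_right β)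
  have hfT : Measurable fun ω => f (toSeq (linData (n := n) β ω)) := hf.comp hTm
  have hfs : Measurable fun ω => f (seqData β ω) := hf.comp (measurable_seqData_right β)
  rw [lintegral_map hf hTm, lintegral_map hf (measurable_seqData_right β), linNoise, seqNoise,
    lintegral_prod _ hfT.aemeasurable, lintegral_prod _ hfs.aemeasurable, invGramLaw,
    lintegral_map hfs.lintegral_prod_right' (measurable_inv_gram n d)]
  refine lintegral_congr_ae ?_
  filter_upwards [ae_gram_posDef hdn] with X hX
  have hu : IsUnit (Xᵀ * X).det := (Matrix.isUnit_iff_isUnit_det _).1 hX.isUnit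
  set S : Mat d d := (Xᵀ * X)⁻¹ with hS
  have hSp : S.PosDef := hX.inv
  set T : Mat d d := CFC.sqrt S with hT
  have hTs : Tᵀ = T := by
    have := (Matrix.nonneg_iff_posSemidef.1 (CFC.sqrt_nonneg S)).1
    rwa [Matrix.IsHermitian, Matrix.conjTranspose_eq_transpose_of_trivial] at this
  have hTT : T * Tᵀ = (S * Xᵀ) * (S * Xᵀ)ᵀ := by
    have hSs : Sᵀ = S := by
      have := hSp.1
      rwa [Matrix.IsHermitian, Matrix.conjTranspose_eq_transpose_of_trivial] at this
    rw [hTs, hT, CFC.sqrt_mul_sqrt_self S (Matrix.nonneg_iff_posSemidef.2 hSp.posSemidef),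
      Matrix.transpose_mul, Matrix.transpose_transpose, hSs]
    calc S = S * (Xᵀ * X) * S := by rw [hS, Matrix.nonsing_inv_mul _ hu, one_mul]
      _ = S * Xᵀ * (X * S) := by simp only [Matrix.mul_assoc]
  have hlaw := map_stdGaussian_eq_of_mul_transpose_eq hTT
  have hg : Measurable fun v : E d => f (β + v, S) := by fun_prop
  have hm : ∀ {k : ℕ} (C : Mat d k), Measurable (Matrix.toEuclideanLin C) := fun C =>
    (LinearMap.continuous_of_finiteDimensional _).measurable
  have h1 : ∀ e : E n, toSeq (linData β (X, e)) = (β + Matrix.toEuclideanLin (S * Xᵀ) e, S) := by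
    intro e
    simp only [toSeq, linData]
    rw [map_add, ← toEuclideanLin_mul_apply, Matrix.mul_assoc, ← hS, Matrix.nonsing_inv_mul _ hu,
      toEuclideanLin_one_apply]
  simp only [h1, seqData]
  rw [← lintegral_map (f := fun v => f (β + v, S)) hg (hm _), ← hlaw, lintegral_map hg (hm _)]

/-! ### Likelihoods -/

/-- The likelihood of the linear model relative to `β = 0`. -/
noncomputable def linLik {n d : ℕ} (x : E n × Mat n d) : E d → ℝ :=
  shiftLik (Matrix.toEuclideanLin x.2ᵀ x.1) (x.2ᵀ * x.2)

/-- The likelihood of the sequence model relative to `θ = 0`. -/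
noncomputable def seqLik {m : ℕ} (x : E m × Mat m m) : E m → ℝ :=
  shiftLik (Matrix.toEuclideanLin x.2⁻¹ x.1) x.2⁻¹

theorem measurable_shiftLik {Ω : Type*} [MeasurableSpace Ω] {d : ℕ} {w : Ω → E d}
    {M : Ω → Mat d d} {b : Ω → E d} (hw : Measurable w) (hM : Measurable M) (hb : Measurable b) :
    Measurable fun ω => shiftLik (w ω) (M ω) (b ω) := by
  unfold shiftLik
  exact ((hb.inner hw).sub ((hb.inner (measurable_toEuclideanLin hM hb)).div_const 2)).exp

theorem measurable_linLik {n d : ℕ} : Measurable (Function.uncurry (linLik (n := n) (d := d))) :=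
  measurable_shiftLik
    (measurable_toEuclideanLin ((measurable_matrix_transpose n d).comp measurable_fst.snd)
      measurable_fst.fst)
    ((measurable_transpose_mul_self n d).comp measurable_fst.snd) measurable_snd

theorem measurable_seqLik {m : ℕ} : Measurable (Function.uncurry (seqLik (m := m))) := by
  have hi : Measurable fun p : (E m × Mat m m) × E m => (p.1.2)⁻¹ :=
    (measurable_matrix_inv m).comp measurable_fst.snd
  exact measurable_shiftLik (measurable_toEuclideanLin hi measurable_fst.fst) hi measurable_snd

theorem seqLik_toSeq {n d : ℕ} {x : E n × Mat n d} (hx : (x.2ᵀ * x.2).PosDef) :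
    seqLik (toSeq x) = linLik x := by
  have hu : IsUnit (x.2ᵀ * x.2).det := (Matrix.isUnit_iff_isUnit_det _).1 hx.isUnit
  simp only [seqLik, linLik, toSeq]
  rw [Matrix.nonsing_inv_nonsing_inv _ hu, ← toEuclideanLin_mul_apply, ← Matrix.mul_assoc,
    Matrix.mul_nonsing_inv _ hu, Matrix.one_mul]

theorem map_linData_eq_withDensity {n d : ℕ} (β : E d) :
    (linNoise n d).map (linData β) =
      ((linNoise n d).map (linData 0)).withDensity fun x => ENNReal.ofReal (linLik x β) := by
  refine Measure.ext_of_lintegral _ fun f hf => ?_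
  have hl : Measurable fun x : E n × Mat n d => ENNReal.ofReal (linLik x β) :=
    (measurable_linLik.comp measurable_prodMk_right).ennreal_ofReal
  have hfβ : Measurable fun ω => f (linData β ω) := hf.comp (measurable_linData_right β)
  have hlf : Measurable fun ω => ((fun x : E n × Mat n d => ENNReal.ofReal (linLik x β)) * f)
      (linData (n := n) 0 ω) := (hl.mul hf).comp (measurable_linData_right 0)
  rw [lintegral_map hf (measurable_linData_right β), lintegral_withDensity_eq_lintegral_mul _ hl hf,
    lintegral_map (hl.mul hf) (measurable_linData_right 0), linNoise,
    lintegral_prod _ hfβ.aemeasurable, lintegral_prod _ hlf.aemeasurable]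
  refine lintegral_congr fun X => ?_
  have hfX : Measurable fun e => f (e, X) := hf.comp measurable_prodMk_right
  simp only [linData, Pi.mul_apply, map_zero, zero_add]
  rw [← lintegral_map (f := fun e => f (e, X)) hfX (measurable_const_add _), map_add_stdGaussian,
    lintegral_withDensity_eq_lintegral_mul _ (measurable_shiftDensity _).ennreal_ofReal hfX]
  refine lintegral_congr fun e => ?_
  rw [Pi.mul_apply]
  congr 2
  rw [linLik, shiftLik, shiftDensity, toEuclideanLin_mul_apply, ← inner_toEuclideanLin_left,
    ← inner_toEuclideanLin_left, real_inner_self_eq_norm_sq]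

theorem map_withDensity_comp {α γ : Type*} [MeasurableSpace α] [MeasurableSpace γ]
    {μ : Measure α} {T : α → γ} (hT : Measurable T) {g : γ → ℝ≥0∞} (hg : Measurable g) :
    (μ.withDensity fun a => g (T a)).map T = (μ.map T).withDensity g := by
  ext s hs
  rw [Measure.map_apply hT hs, withDensity_apply _ (hT hs), withDensity_apply _ hs,
    setLIntegral_map hs hg hT]

theorem ae_map_linData_posDef {n d : ℕ} (hdn : d ≤ n) (β : E d) :
    ∀ᵐ ω ∂(linNoise n d), ((linData β ω).2ᵀ * (linData β ω).2).PosDef :=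
  Measure.quasiMeasurePreserving_fst.ae (ae_gram_posDef hdn)

/-- The likelihood of the sequence model is inherited from the linear model: the likelihood of the
latter factors through `toSeq`. -/
theorem map_seqData_eq_withDensity {n d : ℕ} (hdn : d ≤ n) (θ : E d) :
    (seqNoise (invGramLaw n d)).map (seqData θ) =
      ((seqNoise (invGramLaw n d)).map (seqData 0)).withDensity
        fun x => ENNReal.ofReal (seqLik x θ) := by
  have hcomp : ∀ β : E d, (linNoise n d).map (fun ω => toSeq (linData β ω)) =
      ((linNoise n d).map (linData β)).map toSeq := fun β =>
    (Measure.map_map measurable_toSeq (measurable_linData_right β)).symm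
  have hpd : ∀ᵐ x ∂((linNoise n d).map (linData 0)), (x.2ᵀ * x.2).PosDef := by
    rw [ae_map_iff (p := fun x : E n × Mat n d => (x.2ᵀ * x.2).PosDef)
      (measurable_linData_right 0).aemeasurable
      (((measurable_transpose_mul_self n d).comp measurable_snd) (measurableSet_posDef d))]
    exact ae_map_linData_posDef hdn 0
  have hl : Measurable fun x : E d × Mat d d => ENNReal.ofReal (seqLik x θ) :=
    (measurable_seqLik.comp measurable_prodMk_right).ennreal_ofReal
  rw [← map_toSeq_linData hdn, ← map_toSeq_linData hdn, hcomp, hcomp,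
    ← map_withDensity_comp measurable_toSeq hl,
    map_linData_eq_withDensity]
  congr 1
  refine withDensity_congr_ae ?_
  filter_upwards [hpd] with x hx
  rw [seqLik_toSeq hx]

/-! ### Explicit posterior means -/

/-- Every parameter gives a law absolutely continuous with respect to the one of parameter `0`. -/
theorem ae_linData_of_ae {n d : ℕ} (β : E d) {p : E n × Mat n d → Prop}
    (h : ∀ᵐ x ∂((linNoise n d).map (linData 0)), p x) : ∀ᵐ ω ∂(linNoise n d), p (linData β ω) := by
  refine ae_of_ae_map (measurable_linData_right β).aemeasurable ?_
  rw [map_linData_eq_withDensity]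
  exact (withDensity_absolutelyContinuous _ _).ae_le h

theorem ae_toSeq_linData_of_ae {n d : ℕ} (hdn : d ≤ n) (β : E d) {p : E d × Mat d d → Prop}
    (h : ∀ᵐ x ∂((seqNoise (invGramLaw n d)).map (seqData 0)), p x) :
    ∀ᵐ ω ∂(linNoise n d), p (toSeq (linData β ω)) := by
  refine ae_of_ae_map (measurable_toSeq.comp (measurable_linData_right β)).aemeasurable ?_
  rw [Function.comp_def, map_toSeq_linData hdn, map_seqData_eq_withDensity hdn]
  exact (withDensity_absolutelyContinuous _ _).ae_le h

theorem linPosterior_ae_eq {n d : ℕ} (π : Measure (E d)) [IsProbabilityMeasure π] (β : E d) :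
    ∀ᵐ ω ∂(linNoise n d), posteriorMean π (linNoise n d) linData (linData β ω) =
      weightedMean π (linLik (linData β ω)) :=
  ae_linData_of_ae β (posteriorMean_ae_eq measurable_linData measurable_linLik
    (fun _ _ => shiftLik_pos _ _ _) map_linData_eq_withDensity)

theorem seqPosterior_ae_eq {n d : ℕ} (hdn : d ≤ n) (π : Measure (E d)) [IsProbabilityMeasure π]
    (β : E d) :
    ∀ᵐ ω ∂(linNoise n d),
      posteriorMean π (seqNoise (invGramLaw n d)) seqData (toSeq (linData β ω)) =
        weightedMean π (seqLik (toSeq (linData β ω))) :=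
  ae_toSeq_linData_of_ae hdn β (posteriorMean_ae_eq measurable_seqData measurable_seqLik
    (fun _ _ => shiftLik_pos _ _ _) (map_seqData_eq_withDensity hdn))

/-! ### Ridge estimators -/

theorem inv_gram_add_smul_one {d : ℕ} {G : Mat d d} (hG : G.PosDef) {τ : ℝ} (hτ : 0 < τ) :
    (G + τ⁻¹ • (1 : Mat d d))⁻¹ = τ • ((G⁻¹ + τ • (1 : Mat d d))⁻¹ * G⁻¹) := by
  have hu : IsUnit G.det := (Matrix.isUnit_iff_isUnit_det _).1 hG.isUnit
  have hK : (G + τ⁻¹ • (1 : Mat d d)).PosDef := hG.add (Matrix.PosDef.one.smul (inv_pos.2 hτ))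
  have hKu : IsUnit (G + τ⁻¹ • (1 : Mat d d)).det := (Matrix.isUnit_iff_isUnit_det _).1 hK.isUnit
  have h1 : G * (G⁻¹ + τ • (1 : Mat d d)) = τ • (G + τ⁻¹ • (1 : Mat d d)) := by
    rw [mul_add, Matrix.mul_nonsing_inv _ hu, Matrix.mul_smul, mul_one, smul_add, smul_smul,
      mul_inv_cancel₀ hτ.ne', one_smul, add_comm]
  rw [← Matrix.mul_inv_rev, h1]
  refine Matrix.inv_eq_right_inv ?_
  have := invertibleOfNonzero hτ.ne'
  rw [Matrix.inv_smul _ τ hKu, smul_smul, mul_invOf_self, one_smul, Matrix.mul_nonsing_inv _ hKu]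

theorem linRidge_eq_seqRidgeForm {n d : ℕ} (hd : 1 ≤ d) {c : ℝ≥0∞} (hc : c ≠ ⊤)
    {x : E n × Mat n d} (hx : (x.2ᵀ * x.2).PosDef) :
    linRidge c x = seqRidgeForm c.toReal (toSeq x) := by
  by_cases h0 : c = 0
  · simp [linRidge, seqRidgeForm, h0]
  have hcr : 0 < c.toReal := ENNReal.toReal_pos h0 hc
  have hdr : (0 : ℝ) < d := by exact_mod_cast hd
  have hτ : 0 < c.toReal ^ 2 / d := by positivity
  have hinv : ((d : ℝ≥0∞) / c ^ 2).toReal = (c.toReal ^ 2 / d)⁻¹ := by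
    rw [ENNReal.toReal_div, ENNReal.toReal_pow, inv_div, ENNReal.toReal_natCast]
  rw [linRidge, if_neg h0, hinv, inv_gram_add_smul_one hx hτ, seqRidgeForm]
  simp only [toSeq]
  rw [Matrix.smul_mul, map_smul, LinearMap.smul_apply, Matrix.mul_assoc, toEuclideanLin_mul_apply]

theorem linRidge_top {n d : ℕ} (x : E n × Mat n d) : linRidge ⊤ x = (toSeq x).1 := by
  simp [linRidge, toSeq]

open scoped MatrixOrder in
theorem multivariateGaussian_zero_smul_one {d : ℕ} (s : ℝ) (hs : 0 ≤ s) :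
    multivariateGaussian 0 (s ^ 2 • (1 : Mat d d)) = (stdGaussian (E d)).map fun g => s • g := by
  have hsq : CFC.sqrt (s ^ 2 • (1 : Mat d d)) = s • (1 : Mat d d) := by
    refine CFC.sqrt_unique ?_ ?_
    · rw [Matrix.smul_mul, Matrix.mul_smul, mul_one, smul_smul, sq]
    · exact Matrix.nonneg_iff_posSemidef.2 (Matrix.PosSemidef.one.smul hs)
  rw [multivariateGaussian, hsq]
  congr 1
  ext1 g
  simp

/-- The case `c = 0`, where the prior is a point mass at the origin, is included. -/
theorem weightedMean_gaussian_seqLik {d : ℕ} {x : E d × Mat d d} (hx : x.2.PosDef) (c : ℝ)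
    (hc : 0 ≤ c) :
    weightedMean (multivariateGaussian 0 ((c ^ 2 / d) • (1 : Mat d d))) (seqLik x) =
      seqRidgeForm c x := by
  have hs2 : (c / √d) ^ 2 = c ^ 2 / d := by
    rw [div_pow, Real.sq_sqrt (Nat.cast_nonneg d)]
  have hu : IsUnit x.2.det := (Matrix.isUnit_iff_isUnit_det _).1 hx.isUnit
  have hT : (x.2 + (c ^ 2 / d) • (1 : Mat d d)).PosDef :=
    hx.add_posSemidef (Matrix.PosSemidef.one.smul (by positivity))
  have hTu : IsUnit (x.2 + (c ^ 2 / d) • (1 : Mat d d)).det :=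
    (Matrix.isUnit_iff_isUnit_det _).1 hT.isUnit
  rw [← hs2] at hT hTu ⊢
  rw [multivariateGaussian_zero_smul_one _ (by positivity), seqRidgeForm, ← hs2]
  set s := c / √d
  set u : E d := Matrix.toEuclideanLin (x.2 + s ^ 2 • (1 : Mat d d))⁻¹ x.1 with hud
  have hz : x.1 = Matrix.toEuclideanLin x.2 u + s ^ 2 • u := by
    have : Matrix.toEuclideanLin (x.2 + s ^ 2 • (1 : Mat d d)) u = x.1 := by
      rw [hud, ← toEuclideanLin_mul_apply, Matrix.mul_nonsing_inv _ hTu, toEuclideanLin_one_apply]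
    rw [← this, map_add, map_smul, LinearMap.add_apply, LinearMap.smul_apply,
      toEuclideanLin_one_apply]
  have hw : s • Matrix.toEuclideanLin x.2⁻¹ x.1 =
      s ^ 2 • Matrix.toEuclideanLin x.2⁻¹ (s • u) + s • u := by
    conv_lhs => rw [hz]
    rw [map_add, ← toEuclideanLin_mul_apply, Matrix.nonsing_inv_mul _ hu, toEuclideanLin_one_apply,
      map_smul, map_smul]
    module
  rw [seqLik, weightedMean_gaussian_shiftLik hx.inv.posSemidef hw, smul_smul, sq]

/-! ### Equivariance and risks -/

/-- For an invariant prior the weighted mean is equivariant everywhere, not just almost surely. -/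
theorem weightedMean_orthogonal {d : ℕ} {π : Measure (E d)} {U : Mat d d}
    (hU : U ∈ Matrix.orthogonalGroup (Fin d) ℝ) (hπ : π.map (Matrix.toEuclideanLin U) = π)
    (w : E d) (M : Mat d d) :
    weightedMean π (shiftLik (Matrix.toEuclideanLin U w) (U * M * Uᵀ)) =
      Matrix.toEuclideanLin U (weightedMean π (shiftLik w M)) := by
  set R := orthIsometry U hU with hR
  have hemb : MeasurableEmbedding (Matrix.toEuclideanLin U) :=
    R.toHomeomorph.measurableEmbedding
  have hl : ∀ b, shiftLik (Matrix.toEuclideanLin U w) (U * M * Uᵀ) (Matrix.toEuclideanLin U b) =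
      shiftLik w M b := by
    intro b
    rw [shiftLik, shiftLik, ← toEuclideanLin_mul_apply, Matrix.mul_assoc, Matrix.mul_assoc,
      transpose_mul_self_of_mem hU, mul_one, toEuclideanLin_mul_apply]
    exact congrArg Real.exp (by
      rw [← coe_orthIsometry U hU, LinearIsometryEquiv.inner_map_map,
        LinearIsometryEquiv.inner_map_map])
  have h1 : ∫ b, shiftLik (Matrix.toEuclideanLin U w) (U * M * Uᵀ) b ∂π =
      ∫ b, shiftLik w M b ∂π := by
    conv_lhs => rw [← hπ]
    rw [hemb.integral_map]
    simp_rw [hl]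
  have h2 : ∫ b, shiftLik (Matrix.toEuclideanLin U w) (U * M * Uᵀ) b • b ∂π =
      Matrix.toEuclideanLin U (∫ b, shiftLik w M b • b ∂π) := by
    conv_lhs => rw [← hπ]
    rw [hemb.integral_map]
    simp_rw [hl, ← map_smul]
    exact R.toContinuousLinearEquiv.integral_comp_comm _
  rw [weightedMean, weightedMean, h1, h2, map_smul]

theorem linEquivariant_weightedMean {n d : ℕ} {π : Measure (E d)}
    (hπ : ∀ U ∈ Matrix.orthogonalGroup (Fin d) ℝ, π.map (Matrix.toEuclideanLin U) = π) :
    LinEquivariant fun x : E n × Mat n d => weightedMean π (linLik x) := by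
  intro U hU y X
  have hU' := transpose_mem hU
  simp only [linLik]
  rw [← weightedMean_orthogonal hU' (hπ _ hU'), Matrix.transpose_transpose, Matrix.transpose_mul,
    toEuclideanLin_mul_apply]
  simp only [Matrix.mul_assoc]

theorem seqEquivariant_weightedMean {d : ℕ} {π : Measure (E d)}
    (hπ : ∀ U ∈ Matrix.orthogonalGroup (Fin d) ℝ, π.map (Matrix.toEuclideanLin U) = π) :
    SeqEquivariant fun x : E d × Mat d d => weightedMean π (seqLik x) := by
  intro U hU z S
  simp only [seqLik]
  rw [← weightedMean_orthogonal hU (hπ _ hU), inv_orthogonal_conj hU,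
    ← toEuclideanLin_mul_apply (U * S⁻¹ * Uᵀ), Matrix.mul_assoc _ Uᵀ U,
    transpose_mul_self_of_mem hU, mul_one, toEuclideanLin_mul_apply]

theorem toSeq_mul_orthogonal {n d : ℕ} {U : Mat d d}
    (hU : U ∈ Matrix.orthogonalGroup (Fin d) ℝ) (y : E n) (X : Mat n d) :
    toSeq (y, X * U) = (Matrix.toEuclideanLin Uᵀ (toSeq (y, X)).1, Uᵀ * (toSeq (y, X)).2 * U) := by
  have h : ((X * U)ᵀ * (X * U))⁻¹ = Uᵀ * (Xᵀ * X)⁻¹ * U := by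
    have := inv_orthogonal_conj (transpose_mem hU) (Xᵀ * X)
    rw [Matrix.transpose_transpose] at this
    rw [← this, Matrix.transpose_mul]
    simp only [Matrix.mul_assoc]
  simp only [toSeq]
  rw [h, Matrix.transpose_mul, ← toEuclideanLin_mul_apply, Matrix.mul_assoc _ U,
    ← Matrix.mul_assoc U, mul_transpose_self_of_mem hU, Matrix.one_mul, Matrix.mul_assoc]

theorem SeqEquivariant.comp_toSeq {n d : ℕ} {f : E d × Mat d d → E d} (hf : SeqEquivariant f) :
    LinEquivariant fun x : E n × Mat n d => f (toSeq x) := by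
  intro U hU y X
  simp only
  rw [toSeq_mul_orthogonal hU, ← Prod.mk.eta (p := toSeq (y, X)), hf _ (transpose_mem hU),
    Matrix.transpose_transpose]

theorem linRisk_congr {n d : ℕ} {f g : E n × Mat n d → E d} {β : E d}
    (h : ∀ᵐ ω ∂(linNoise n d), f (linData β ω) = g (linData β ω)) : linRisk f β = linRisk g β := by
  refine lintegral_congr_ae ?_
  filter_upwards [h] with ω hω
  rw [hω]

theorem seqRisk_eq_linRisk {n d : ℕ} (hdn : d ≤ n) {f : E d × Mat d d → E d} (hf : Measurable f)
    (θ : E d) : seqRisk (invGramLaw n d) f θ = linRisk (fun x : E n × Mat n d => f (toSeq x)) θ := by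
  have hm : Measurable fun x => ‖f x - θ‖ₑ ^ 2 := by fun_prop
  have hT : Measurable fun ω => toSeq (linData (n := n) θ ω) :=
    measurable_toSeq.comp (measurable_linData_right θ)
  rw [seqRisk, sqRisk, ← lintegral_map hm (measurable_seqData_right θ), ← map_toSeq_linData hdn,
    lintegral_map hm hT]
  rfl

theorem map_linNoise_orthogonal {n d : ℕ} {U : Mat d d}
    (hU : U ∈ Matrix.orthogonalGroup (Fin d) ℝ) :
    (linNoise n d).map (fun ω : Mat n d × E n => (ω.1 * U, ω.2)) = linNoise n d := by
  have hm : Measurable fun X : Mat n d => X * U :=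
    (show Continuous fun X : Mat n d => X * U by fun_prop).measurable
  have h := Measure.map_prod_map (gaussianDesign n d) (stdGaussian (E n)) hm measurable_id
  rw [map_gaussianDesign_mul hU, Measure.map_id] at h
  exact h.symm

/-- Equivariant estimators have constant risk on spheres centred at the origin. -/
theorem LinEquivariant.linRisk_eq {n d : ℕ} {f : E n × Mat n d → E d} (hf : LinEquivariant f)
    (hfm : Measurable f) {β θ : E d} (h : ‖β‖ = ‖θ‖) : linRisk f β = linRisk f θ := by
  obtain ⟨U, hU, rfl⟩ := exists_orthogonal_map_eq h
  have hm : Measurable fun ω : Mat n d × E n => (ω.1 * U, ω.2) :=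
    ((show Continuous fun X : Mat n d => X * U by fun_prop).measurable.comp
      measurable_fst).prodMk measurable_snd
  have hg : Measurable fun ω : Mat n d × E n => ‖f (linData β ω) - β‖ₑ ^ 2 :=
    ((hfm.comp (measurable_linData_right β)).sub_const β).enorm.pow_const 2
  rw [linRisk, linRisk, sqRisk, sqRisk]
  conv_lhs => rw [← map_linNoise_orthogonal hU]
  rw [lintegral_map hg hm]
  refine lintegral_congr fun ω => ?_
  have h1 : f (linData β (ω.1 * U, ω.2)) =
      Matrix.toEuclideanLin Uᵀ (f (linData (Matrix.toEuclideanLin U β) ω)) := by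
    rw [linData, linData, hf U hU, toEuclideanLin_mul_apply]
  have h2 : β = Matrix.toEuclideanLin Uᵀ (Matrix.toEuclideanLin U β) := by
    rw [← toEuclideanLin_mul_apply, transpose_mul_self_of_mem hU, toEuclideanLin_one_apply]
  have h3 : ‖f (linData β (ω.1 * U, ω.2)) - β‖ =
      ‖f (linData (Matrix.toEuclideanLin U β) ω) - Matrix.toEuclideanLin U β‖ := by
    rw [h1]
    conv_lhs => rw [h2]
    rw [← map_sub, norm_toEuclideanLin_of_mem (transpose_mem hU)]
    rw [← h2]
  rw [← ofReal_norm, ← ofReal_norm, h3]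

/-! ### Minimaxity on spheres and the common value of the risks -/

section Sphere

variable {n d : ℕ} {c : ℝ} {β : E d}

/-- `linUnif` agrees almost surely with an everywhere equivariant version, which has the same
risk. -/
theorem linRisk_linUnif (hd : 1 ≤ d) (c : ℝ) (β : E d) :
    linRisk (n := n) (linUnif c) β =
      linRisk (fun x : E n × Mat n d => weightedMean (sphereUniform d c) (linLik x)) β := by
  have := isProbabilityMeasure_sphereUniform hd c
  exact linRisk_congr (linPosterior_ae_eq _ β)

theorem linRisk_linUnif_eq (hd : 1 ≤ d) {θ : E d} (h : ‖β‖ = ‖θ‖) :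
    linRisk (n := n) (linUnif c) β = linRisk (n := n) (linUnif c) θ := by
  rw [linRisk_linUnif hd, linRisk_linUnif hd]
  exact (linEquivariant_weightedMean fun U hU => map_sphereUniform c hU).linRisk_eq
    (measurable_weightedMean _ measurable_linLik) h

/-- The Bayes estimator has constant risk on the sphere, so this risk is its Bayes risk, which is
minimal. -/
theorem linRisk_linUnif_le_lintegral (hd : 1 ≤ d) (hβ : ‖β‖ = c) {f : E n × Mat n d → E d}
    (hf : Measurable f) :
    linRisk (n := n) (linUnif c) β ≤ ∫⁻ b, linRisk f b ∂(sphereUniform d c) := by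
  have := isProbabilityMeasure_sphereUniform hd c
  have hc : 0 ≤ c := hβ ▸ norm_nonneg β
  calc linRisk (n := n) (linUnif c) β
      = ∫⁻ _, linRisk (n := n) (linUnif c) β ∂(sphereUniform d c) := by simp
    _ = ∫⁻ b, linRisk (n := n) (linUnif c) b ∂(sphereUniform d c) := by
        refine lintegral_congr_ae ?_
        filter_upwards [sphereUniform_ae_mem hc] with b hb
        exact linRisk_linUnif_eq hd (hβ.trans (mem_sphere_zero_iff_norm.1 hb).symm)
    _ ≤ _ := lintegral_sqRisk_posteriorMean_le measurable_linData hf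

theorem linRisk_linUnif_eq_linEquivRisk (hd : 1 ≤ d) (hβ : ‖β‖ = c) :
    linRisk (n := n) (linUnif c) β = linEquivRisk n β := by
  have := isProbabilityMeasure_sphereUniform hd c
  have hc : 0 ≤ c := hβ ▸ norm_nonneg β
  refine le_antisymm (le_iInf fun f => le_iInf fun hf => le_iInf fun he => ?_) ?_
  · refine (linRisk_linUnif_le_lintegral hd hβ hf).trans ?_
    calc ∫⁻ b, linRisk f b ∂(sphereUniform d c)
        ≤ ∫⁻ _, linRisk f β ∂(sphereUniform d c) := by
          refine lintegral_mono_ae ?_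
          filter_upwards [sphereUniform_ae_mem hc] with b hb
          exact (he.linRisk_eq hf ((mem_sphere_zero_iff_norm.1 hb).trans hβ.symm)).le
      _ = linRisk f β := by simp
  · rw [linRisk_linUnif hd]
    exact iInf_le_of_le _ (iInf_le_of_le (measurable_weightedMean _ measurable_linLik)
      (iInf_le _ (linEquivariant_weightedMean fun U hU => map_sphereUniform c hU)))

theorem linRisk_linUnif_eq_linSphereRisk (hd : 1 ≤ d) (hβ : ‖β‖ = c) :
    linRisk (n := n) (linUnif c) β = linSphereRisk n d c := by
  have := isProbabilityMeasure_sphereUniform hd c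
  have hc : 0 ≤ c := hβ ▸ norm_nonneg β
  refine le_antisymm (le_iInf fun f => le_iInf fun hf => ?_) ?_
  · refine (linRisk_linUnif_le_lintegral hd hβ hf).trans ?_
    calc ∫⁻ b, linRisk f b ∂(sphereUniform d c)
        ≤ ∫⁻ _, (⨆ θ ∈ Metric.sphere (0 : E d) c, linRisk f θ) ∂(sphereUniform d c) := by
          refine lintegral_mono_ae ?_
          filter_upwards [sphereUniform_ae_mem hc] with b hb
          exact le_iSup₂ (f := fun θ (_ : θ ∈ Metric.sphere (0 : E d) c) => linRisk f θ) b hb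
      _ = _ := by simp; rfl
  · refine iInf_le_of_le (linUnif c) (iInf_le_of_le (measurable_posteriorMean _ _ _)
      (iSup₂_le fun θ hθ => ?_))
    exact (linRisk_linUnif_eq hd ((mem_sphere_zero_iff_norm.1 hθ).trans hβ.symm)).le

theorem linSphereRisk_le_seqSphereRisk (hdn : d ≤ n) :
    linSphereRisk n d c ≤ seqSphereRisk (invGramLaw n d) c := by
  refine le_iInf fun f => le_iInf fun hf => ?_
  refine iInf_le_of_le (fun x => f (toSeq x)) (iInf_le_of_le (hf.comp measurable_toSeq) ?_)
  refine iSup₂_mono fun θ _ => ?_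
  exact (seqRisk_eq_linRisk hdn hf θ).ge

theorem linEquivRisk_le_seqEquivRisk (hdn : d ≤ n) :
    linEquivRisk n β ≤ seqEquivRisk (invGramLaw n d) β := by
  refine le_iInf fun f => le_iInf fun hf => le_iInf fun he => ?_
  rw [seqRisk_eq_linRisk hdn hf]
  exact iInf_le_of_le (fun x => f (toSeq x)) (iInf_le_of_le (hf.comp measurable_toSeq)
    (iInf_le _ he.comp_toSeq))

theorem linUnif_ae_eq_seqUnif (hd : 1 ≤ d) (hdn : d ≤ n) (c : ℝ) (β : E d) :
    ∀ᵐ ω ∂(linNoise n d),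
      linUnif c (linData β ω) = seqUnif (invGramLaw n d) c (toSeq (linData β ω)) := by
  have := isProbabilityMeasure_sphereUniform hd c
  filter_upwards [linPosterior_ae_eq (n := n) (sphereUniform d c) β,
    seqPosterior_ae_eq hdn (sphereUniform d c) β, ae_map_linData_posDef hdn β] with ω h1 h2 h3
  rw [linUnif, seqUnif, h1, h2, seqLik_toSeq h3]

theorem seqRisk_seqUnif (hd : 1 ≤ d) (hdn : d ≤ n) (c : ℝ) (β : E d) :
    seqRisk (invGramLaw n d) (seqUnif (invGramLaw n d) c) β =
      linRisk (n := n) (linUnif c) β := by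
  have hm : Measurable (seqUnif (invGramLaw n d) c) := measurable_posteriorMean _ _ _
  rw [seqRisk_eq_linRisk hdn hm]
  exact (linRisk_congr (linUnif_ae_eq_seqUnif hd hdn c β)).symm

theorem seqSphereRisk_le (hd : 1 ≤ d) (hdn : d ≤ n) (hβ : ‖β‖ = c) :
    seqSphereRisk (invGramLaw n d) c ≤ linRisk (n := n) (linUnif c) β := by
  refine iInf_le_of_le (seqUnif (invGramLaw n d) c) (iInf_le_of_le (measurable_posteriorMean _ _ _)
    (iSup₂_le fun θ hθ => ?_))
  refine (seqRisk_seqUnif hd hdn c θ).le.trans ?_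
  exact (linRisk_linUnif_eq hd ((mem_sphere_zero_iff_norm.1 hθ).trans hβ.symm)).le

theorem seqEquivRisk_le (hd : 1 ≤ d) (hdn : d ≤ n) (c : ℝ) (β : E d) :
    seqEquivRisk (invGramLaw n d) β ≤ linRisk (n := n) (linUnif c) β := by
  have := isProbabilityMeasure_sphereUniform hd c
  have hm : Measurable fun x : E d × Mat d d => weightedMean (sphereUniform d c) (seqLik x) :=
    measurable_weightedMean _ measurable_seqLik
  refine iInf_le_of_le _ (iInf_le_of_le hm (iInf_le_of_le
    (seqEquivariant_weightedMean fun U hU => map_sphereUniform c hU) ?_))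
  rw [seqRisk_eq_linRisk hdn hm, linRisk_linUnif hd]
  refine (linRisk_congr ?_).le
  filter_upwards [ae_map_linData_posDef hdn β] with ω h
  rw [seqLik_toSeq h]

end Sphere

/-! ### Agreement of the ridge estimators along the data -/

theorem seqRidge_ae_eq_seqRidgeForm {n d : ℕ} (hdn : d ≤ n) {c : ℝ≥0∞} (hc : c ≠ ⊤) (β : E d) :
    ∀ᵐ ω ∂(linNoise n d), seqRidge (invGramLaw n d) c (toSeq (linData β ω)) =
      seqRidgeForm c.toReal (toSeq (linData β ω)) := by
  filter_upwards [seqPosterior_ae_eq hdn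
    (multivariateGaussian 0 ((c.toReal ^ 2 / d) • (1 : Mat d d))) β,
    ae_map_linData_posDef hdn β] with ω h1 h2
  rw [seqRidge, if_neg hc, h1, weightedMean_gaussian_seqLik _ _ ENNReal.toReal_nonneg]
  exact h2.inv

theorem linRidge_ae_eq_seqRidge {n d : ℕ} (hd : 1 ≤ d) (hdn : d ≤ n) (c : ℝ≥0∞) (β : E d) :
    ∀ᵐ ω ∂(linNoise n d),
      linRidge c (linData β ω) = seqRidge (invGramLaw n d) c (toSeq (linData β ω)) := by
  by_cases hc : c = ⊤
  · refine Filter.Eventually.of_forall fun ω => ?_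
    rw [seqRidge, if_pos hc, hc, linRidge_top]
  · filter_upwards [seqRidge_ae_eq_seqRidgeForm hdn hc β, ae_map_linData_posDef hdn β] with ω h1 h2
    rw [h1, linRidge_eq_seqRidgeForm hd hc h2]

theorem measurable_seqRidge {m : ℕ} (ν : Measure (Mat m m)) [IsFiniteMeasure ν] (c : ℝ≥0∞) :
    Measurable (seqRidge ν c) := by
  unfold seqRidge
  split_ifs
  · exact measurable_fst
  · exact measurable_posteriorMean _ _ _

end DenseRegression

open DenseRegression

theorem proposition10 (n d : ℕ) (hd : 1 ≤ d) (hdn : d ≤ n) :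
    -- `Σ = (XᵀX)⁻¹` is admissible in the sequence model, and `(z, Σ)` follows that model
    IsSeqCovLaw (invGramLaw n d) ∧
    (∀ β : E d, (linNoise n d).map (fun ω => toSeq (linData β ω)) =
      (seqNoise (invGramLaw n d)).map (seqData β)) ∧
    -- part (a)
    (∀ β : E d,
      (∀ c : ℝ, 0 ≤ c → ∀ᵐ ω ∂(linNoise n d),
        linUnif c (linData β ω) = seqUnif (invGramLaw n d) c (toSeq (linData β ω))) ∧
      (∀ c : ℝ≥0∞,
        (∀ᵐ ω ∂(linNoise n d),
          linRidge c (linData β ω) = seqRidge (invGramLaw n d) c (toSeq (linData β ω))) ∧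
        (c ≠ ⊤ → ∀ᵐ ω ∂(linNoise n d),
          seqRidge (invGramLaw n d) c (toSeq (linData β ω)) =
            seqRidgeForm c.toReal (toSeq (linData β ω))) ∧
        linRisk (n := n) (linRidge c) β =
          seqRisk (invGramLaw n d) (seqRidge (invGramLaw n d) c) β)) ∧
    -- part (b)
    (∀ (c : ℝ) (β θ : E d), ‖θ‖ = c → ‖β‖ = c →
      linRisk (n := n) (linUnif c) β = linEquivRisk n β ∧
      linEquivRisk n β = linSphereRisk n d c ∧
      linSphereRisk n d c = seqSphereRisk (invGramLaw n d) c ∧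
      seqSphereRisk (invGramLaw n d) c = seqEquivRisk (invGramLaw n d) θ ∧
      seqEquivRisk (invGramLaw n d) θ =
        seqRisk (invGramLaw n d) (seqUnif (invGramLaw n d) c) θ) := by
  refine ⟨isSeqCovLaw_invGramLaw hdn, map_toSeq_linData hdn, fun β =>
    ⟨fun c _ => linUnif_ae_eq_seqUnif hd hdn c β, fun c =>
      ⟨linRidge_ae_eq_seqRidge hd hdn c β, fun hc => seqRidge_ae_eq_seqRidgeForm hdn hc β, ?_⟩⟩, ?_⟩
  · rw [seqRisk_eq_linRisk hdn (measurable_seqRidge _ _)]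
    exact linRisk_congr (linRidge_ae_eq_seqRidge hd hdn c β)
  · intro c β θ hθ hβ
    have hβθ := linRisk_linUnif_eq (n := n) (c := c) hd (hβ.trans hθ.symm)
    have h1 := linRisk_linUnif_eq_linEquivRisk (n := n) hd hβ
    have h2 := linRisk_linUnif_eq_linSphereRisk (n := n) hd hβ
    have h3 : linSphereRisk n d c = seqSphereRisk (invGramLaw n d) c :=
      (linSphereRisk_le_seqSphereRisk hdn).antisymm (h2 ▸ seqSphereRisk_le hd hdn hβ)
    have h4 : seqEquivRisk (invGramLaw n d) θ = linRisk (n := n) (linUnif c) θ :=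
      (seqEquivRisk_le hd hdn c θ).antisymm
        ((linRisk_linUnif_eq_linEquivRisk hd hθ).le.trans (linEquivRisk_le_seqEquivRisk hdn))
    refine ⟨h1, h1.symm.trans h2, h3, ?_, ?_⟩
    · rw [← h3, ← h2, h4, hβθ]
    · rw [h4, seqRisk_seqUnif hd hdn]
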